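/- Consider a matrix $M\in\mathbb{Q}^{3\times 3}$, a starting point $s\in\mathbb{Q}^3$ and an atomic semialgebraic set $T=\{x\in\mathbb{R}^3 : p(x)\sim 0\}$, where $p\in\mathbb{Z}[x_1,x_2,x_3]$ and ${\sim}\in\{>,\geq\}$. Rational numbers are given by numerator and denominator in lowest terms, and $p$ is given by the list of all its coefficients $c_{i,j,k}$, $0\le i,j,k\le\deg(p)$ (zeros included), where $\deg(p)$ is the total degree of $p$ (taken to be $0$ if $p=0$); all integers are written in binary. Let $\|M\|$, $\|s\|$, $\|p\|$ be the bit lengths of these representations and $\|\mathcal{I}_T\|=\|M\|+\|s\|+\|p\|$. There are a constant $C$, independent of $M$, $s$ and $T$, and an algorithm which on input $(M,s,p,\sim)$ computes a set $X\subseteq\{0,1\}$, such that the following holds whenever all three eigenvalues of $M$ (counted with algebraic multiplicity) are real: there is a natural number $N\le 2^{\|\mathcal{I}_T\|^{C}}$ such that for all integers $n>N$, $$M^n s\in T \iff n \bmod 2\in X .$$ -/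

import Mathlib

namespace OrbitLDS

open MvPolynomial Matrix

/-- An atomic semialgebraic predicate on `ℝ³`: one polynomial inequality `p(x) > 0`
(`strict = true`) or `p(x) ≥ 0` (`strict = false`), where `p` has integer coefficients. -/
structure AtomicSemialgebraic where
  poly : MvPolynomial (Fin 3) ℤ
  strict : Bool

/-- The subset of `ℝ³` defined by an atomic predicate. -/
def AtomicSemialgebraic.toSet (T : AtomicSemialgebraic) : Set (Fin 3 → ℝ) :=
  {x | if T.strict then 0 < aeval x T.poly else 0 ≤ aeval x T.poly}

/-- The `n`-th point `Mⁿ s` of the orbit, as a point of `ℝ³`. -/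
def orbit (M : Matrix (Fin 3) (Fin 3) ℚ) (s : Fin 3 → ℚ) (n : ℕ) : Fin 3 → ℝ :=
  fun i => (((M ^ n) *ᵥ s) i : ℝ)

/-- All three eigenvalues of `M`, counted with algebraic multiplicity, are real. -/
def HasThreeRealEigenvalues (M : Matrix (Fin 3) (Fin 3) ℚ) : Prop :=
  ∃ ρ : Fin 3 → ℝ,
    (M.map (fun q : ℚ => (q : ℝ))).charpoly = ∏ i, (Polynomial.X - Polynomial.C (ρ i))

/-! ### Representation of the input by lists of integers -/

/-- A rational number is given by its numerator and denominator in lowest terms. -/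
def ratCode (q : ℚ) : List ℤ := [q.num, (q.den : ℤ)]

/-- A vector is given by the list of its entries. -/
def vecCode (s : Fin 3 → ℚ) : List ℤ :=
  (List.finRange 3).flatMap fun i => ratCode (s i)

/-- A matrix is given by the list of its entries, row by row. -/
def matCode (M : Matrix (Fin 3) (Fin 3) ℚ) : List ℤ :=
  (List.finRange 3).flatMap fun i => vecCode (M i)

/-- A polynomial `p` is given by the list of all its coefficients `c i j k` with
`0 ≤ i, j, k ≤ deg p`, zeros included, in lexicographic order. -/
noncomputable def polyCode (p : MvPolynomial (Fin 3) ℤ) : List ℤ :=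
  (List.range (p.totalDegree + 1)).flatMap fun i =>
    (List.range (p.totalDegree + 1)).flatMap fun j =>
      (List.range (p.totalDegree + 1)).map fun k =>
        p.coeff (Finsupp.equivFunOnFinite.symm ![i, j, k])

/-- The bit length of an integer in binary: a sign bit and the binary digits of `|z|`. -/
def bitLength (z : ℤ) : ℕ := 1 + Nat.size z.natAbs

/-- The bit length of a list of integers. -/
def listSize (l : List ℤ) : ℕ := (l.map bitLength).sum

/-- The size `‖M‖ + ‖s‖ + ‖p‖` of an instance. -/
noncomputable def instanceSize (M : Matrix (Fin 3) (Fin 3) ℚ) (s : Fin 3 → ℚ)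
    (T : AtomicSemialgebraic) : ℕ :=
  listSize (matCode M) + listSize (vecCode s) + listSize (polyCode T.poly)

/-- The data handed to an algorithm: matrix, starting point, polynomial, and the kind
of inequality. -/
abbrev Input : Type := List ℤ × List ℤ × List ℤ × Bool

/-- The representation of an instance as an input for an algorithm. -/
noncomputable def instanceCode (M : Matrix (Fin 3) (Fin 3) ℚ) (s : Fin 3 → ℚ)
    (T : AtomicSemialgebraic) : Input :=
  (matCode M, vecCode s, polyCode T.poly, T.strict)

end OrbitLDS

/-! ### Primitive recursive integer arithmetic -/

namespace PrimrecArith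

open Primrec

variable {α : Type*} [Primcodable α]

/-! Multiply `M` and `s` by the products of their denominators. This gives an integer matrix `A`
whose eigenvalues `α` are real roots of a monic integer cubic. Newton interpolation at the
eigenvalues writes `Aⁿ s`, up to one fixed nonzero factor `W`, in terms `c * n ^ m * α i ^ n` with
`m ≤ 2` and `c` in `ℤ[α]` (`exists_pow_mulVec_expPoly`). Substituting into the homogenized `p`, the
sign of `p (Mⁿ s)` is, up to the constant sign of a power of `W`, the sign of a sum of terms `c * n
^ m * β ^ n` with `c` and `β` in `ℤ[α]`.

For `n = 2k + r` the bases become `β² ≥ 0`, so nothing oscillates within a parity class: after equal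
terms are collected, the surviving term with largest base, then largest degree, decides the sign
(`exists_sign_eventually`). Making this effective needs lower bounds for nonzero collected
coefficients and for gaps between bases. Both are integer polynomials in `α`. The product of the
nonzero values of such a polynomial over all six permutations of the roots is a nonzero integer, so
if all these values are at most `B` and `B ≥ 1`, a nonzero one is at least `B⁻⁵`
(`ConjBounded.one_le_abs_mul`). Tracking `B` through the construction gives a threshold `2 ^ O(S³)`
in the instance size `S`.

The algorithm needs no eigenvalues: for each residue it tests the sign once, in exact integer
arithmetic, at an index of that parity beyond the threshold. Every operation involved is primitive
recursive. -/

theorem encode_int_natCast (n : ℕ) : Encodable.encode (n : ℤ) = 2 * n := by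
  rfl

theorem encode_int_negSucc (n : ℕ) : Encodable.encode (Int.negSucc n) = 2 * n + 1 := by
  rfl

/-- The parity of the code of an integer is its sign, and half the code is its magnitude up to an
offset of one for negatives. -/
theorem int_toNat : Primrec Int.toNat := by
  have h : Primrec fun z : ℤ =>
      if Encodable.encode z % 2 = 0 then Encodable.encode z / 2 else 0 :=
    Primrec.ite (Primrec.eq.comp (nat_mod.comp Primrec.encode (const 2)) (const 0))
      (nat_div.comp Primrec.encode (const 2)) (const 0)
  refine h.of_eq fun z => ?_
  rcases z with n | n
  · have := encode_int_natCast n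
    simp only [Int.ofNat_eq_natCast, this]
    simp
  · simp only [encode_int_negSucc]
    rw [if_neg (by omega)]
    rfl

theorem int_toNat_neg : Primrec fun z : ℤ => (-z).toNat := by
  have h : Primrec fun z : ℤ =>
      if Encodable.encode z % 2 = 0 then 0 else Encodable.encode z / 2 + 1 :=
    Primrec.ite (Primrec.eq.comp (nat_mod.comp Primrec.encode (const 2)) (const 0))
      (const 0) (succ.comp (nat_div.comp Primrec.encode (const 2)))
  refine h.of_eq fun z => ?_
  rcases z with n | n
  · have := encode_int_natCast n
    simp only [Int.ofNat_eq_natCast, this]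
    simp
  · simp only [encode_int_negSucc]
    rw [if_neg (by omega)]
    have : (-Int.negSucc n).toNat = n + 1 := by
      rw [Int.neg_negSucc]; simp
    rw [this]
    omega

theorem int_natAbs : Primrec Int.natAbs :=
  (nat_add.comp int_toNat int_toNat_neg).of_eq fun z => by omega

theorem int_subNat : Primrec₂ fun a b : ℕ => (a : ℤ) - b := by
  have h : Primrec fun p : ℕ × ℕ => Denumerable.ofNat ℤ
      (if p.2 ≤ p.1 then 2 * (p.1 - p.2) else 2 * (p.2 - p.1 - 1) + 1) :=
    (Primrec.ofNat ℤ).comp (Primrec.ite (nat_le.comp snd fst)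
      (nat_mul.comp (const 2) (nat_sub.comp fst snd))
      (succ.comp (nat_mul.comp (const 2) (nat_sub.comp (nat_sub.comp snd fst) (const 1)))))
  refine h.of_eq fun p => ?_
  obtain ⟨a, b⟩ := p
  have key : ∀ z : ℤ, ∀ n, Encodable.encode z = n → Denumerable.ofNat ℤ n = z := by
    rintro z _ rfl
    exact Denumerable.ofNat_encode z
  dsimp only
  split_ifs with hab
  · apply key
    rw [← encode_int_natCast]
    congr 1
    omega
  · apply key
    rw [← encode_int_negSucc]
    congr 1
    rw [Int.negSucc_eq]
    omega

/-- Every `z` equals `z.toNat - (-z).toNat`, so ring operations on `ℤ` reduce to operations on `ℕ`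
and one final `int_subNat`. -/
theorem int_add : Primrec₂ ((· + ·) : ℤ → ℤ → ℤ) := by
  have h : Primrec fun p : ℤ × ℤ =>
      ((p.1.toNat + p.2.toNat : ℕ) : ℤ) - ((-p.1).toNat + (-p.2).toNat : ℕ) :=
    int_subNat.comp (nat_add.comp (int_toNat.comp fst) (int_toNat.comp snd))
      (nat_add.comp (int_toNat_neg.comp fst) (int_toNat_neg.comp snd))
  exact h.of_eq fun p => by dsimp only; omega

theorem int_mul : Primrec₂ ((· * ·) : ℤ → ℤ → ℤ) := by
  have h : Primrec fun p : ℤ × ℤ =>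
      ((p.1.toNat * p.2.toNat + (-p.1).toNat * (-p.2).toNat : ℕ) : ℤ) -
        (p.1.toNat * (-p.2).toNat + (-p.1).toNat * p.2.toNat : ℕ) :=
    int_subNat.comp
      (nat_add.comp (nat_mul.comp (int_toNat.comp fst) (int_toNat.comp snd))
        (nat_mul.comp (int_toNat_neg.comp fst) (int_toNat_neg.comp snd)))
      (nat_add.comp (nat_mul.comp (int_toNat.comp fst) (int_toNat_neg.comp snd))
        (nat_mul.comp (int_toNat_neg.comp fst) (int_toNat.comp snd)))
  refine h.of_eq fun p => ?_
  obtain ⟨a, b⟩ := p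
  have ha : a = a.toNat - (-a).toNat := by omega
  have hb : b = b.toNat - (-b).toNat := by omega
  dsimp only
  conv_rhs => rw [ha, hb]
  push_cast
  ring

theorem int_pow {f : α → ℤ} {g : α → ℕ} (hf : Primrec f) (hg : Primrec g) :
    Primrec fun a => f a ^ g a := by
  have h : Primrec fun a => (fun x : ℤ => x * f a)^[g a] 1 :=
    nat_iterate hg (const 1) (int_mul.comp snd (hf.comp fst)).to₂
  exact h.of_eq fun a => by rw [mul_right_iterate_apply, one_mul]

theorem nat_pow : Primrec₂ ((· ^ ·) : ℕ → ℕ → ℕ) :=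
  Primrec₂.unpaired'.1 Nat.Primrec.pow

theorem int_pos : PrimrecPred fun z : ℤ => 0 < z :=
  (nat_lt.comp (const 0) int_toNat).of_eq fun z => by omega

theorem int_nonneg : PrimrecPred fun z : ℤ => 0 ≤ z :=
  (Primrec.eq.comp int_toNat_neg (const 0)).of_eq fun z => by omega

theorem finset_sum {ι : Type*} (s : Finset ι) {f : ι → α → ℤ} (hf : ∀ i, Primrec (f i)) :
    Primrec fun a => ∑ i ∈ s, f i a := by
  classical
  induction s using Finset.induction_on with
  | empty => exact (const 0).of_eq fun a => by simp
  | insert i s hi ih =>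
    exact (int_add.comp (hf i) ih).of_eq fun a => by rw [Finset.sum_insert hi]

theorem finset_prod {ι : Type*} (s : Finset ι) {f : ι → α → ℤ} (hf : ∀ i, Primrec (f i)) :
    Primrec fun a => ∏ i ∈ s, f i a := by
  classical
  induction s using Finset.induction_on with
  | empty => exact (const 1).of_eq fun a => by simp
  | insert i s hi ih =>
    exact (int_mul.comp (hf i) ih).of_eq fun a => by rw [Finset.prod_insert hi]

theorem list_sum_int {f : α → List ℤ} (hf : Primrec f) : Primrec fun a => (f a).sum :=
  (list_foldr hf (const 0) (int_add.comp (fst.comp snd) (snd.comp snd)).to₂).of_eq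
    fun a => by rw [List.sum_eq_foldr]

theorem list_sum_nat {f : α → List ℕ} (hf : Primrec f) : Primrec fun a => (f a).sum :=
  (list_foldr hf (const 0) (nat_add.comp (fst.comp snd) (snd.comp snd)).to₂).of_eq
    fun a => by rw [List.sum_eq_foldr]

end PrimrecArith

/-! ### Simulating the orbit in integer arithmetic -/

namespace OrbitLDS

open Matrix

/-- The exponent triples in the cube `[0, b)³`, in lexicographic order. -/
def expTriples (b : ℕ) : List (ℕ × ℕ × ℕ) :=
  (List.range b).flatMap fun i => (List.range b).flatMap fun j =>
    (List.range b).map fun k => (i, j, k)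

/-- The monomial with exponents `e` at `x`, homogenized by `q` to degree `m`. -/
def homMonomial {R : Type*} [CommRing R] (m : ℕ) (x : Fin 3 → R) (q : R) (e : ℕ × ℕ × ℕ) : R :=
  x 0 ^ e.1 * x 1 ^ e.2.1 * x 2 ^ e.2.2 * q ^ (m - e.1 - e.2.1 - e.2.2)

section Scaled

variable {ι : Type*} [Fintype ι] (idx : ι → ℕ) (l : List ℤ)

/-- The product of the denominators in a list `[num, den, num, den, …]`. -/
def denProd : ℤ := ∏ a, l.getD (2 * idx a + 1) 1

/-- An entry of a list of fractions, multiplied by the product of all denominators. -/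
def scaledEntry [DecidableEq ι] (a : ι) : ℤ :=
  l.getD (2 * idx a) 0 * ∏ b ∈ Finset.univ.erase a, l.getD (2 * idx b + 1) 1

end Scaled

/-- The position of a matrix entry in the list of entries. -/
def matIdx (p : Fin 3 × Fin 3) : ℕ := 3 * p.1 + p.2

/-- The position of a vector entry in the list of entries. -/
def vecIdx (i : Fin 3) : ℕ := i

/-- The matrix with code `l`, multiplied by all its denominators. -/
def scaledMat (l : List ℤ) : Matrix (Fin 3) (Fin 3) ℤ :=
  Matrix.of fun i j => scaledEntry matIdx l (i, j)

/-- The `n`-th orbit point, multiplied by `scaledDen`. -/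
def scaledOrbit (w : Input) (n : ℕ) : Fin 3 → ℤ :=
  (fun x => scaledMat w.1 *ᵥ x)^[n] (scaledEntry vecIdx w.2.1)

/-- A common denominator of the coordinates of the `n`-th orbit point. -/
def scaledDen (w : Input) (n : ℕ) : ℤ := denProd vecIdx w.2.1 * denProd matIdx w.1 ^ n

/-- The largest `b` with `b³ ≤ m`. -/
def cubeRoot (m : ℕ) : ℕ := Nat.findGreatest (fun b => b ^ 3 ≤ m) m

/-- The value of the input polynomial at the `n`-th orbit point, times a power of the
denominator. -/
def scaledValue (w : Input) (n : ℕ) : ℤ :=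
  ((List.range w.2.2.1.length).map fun t => w.2.2.1.getD t 0 *
    homMonomial (3 * (cubeRoot w.2.2.1.length - 1)) (scaledOrbit w n) (scaledDen w n)
      ((expTriples (cubeRoot w.2.2.1.length)).getD t (0, 0, 0))).sum

/-- The sign test for the `n`-th orbit point. -/
def signTest (w : Input) (n : ℕ) : Prop :=
  if w.2.2.2 = true then 0 < scaledValue w n else 0 ≤ scaledValue w n

/-- A crude upper bound for the size of an input. -/
def crudeSize (w : Input) : ℕ :=
  ((w.1 ++ w.2.1 ++ w.2.2.1).map fun z => 1 + z.natAbs).sum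

/-- The index at which the residue class `r` modulo `2` is tested. -/
def testIndex (C : ℕ) (w : Input) (r : ℕ) : ℕ := 2 * 2 ^ (crudeSize w ^ C) + 2 + r

open Classical in
/-- The residues modulo `2` that pass the sign test at their test index. -/
noncomputable def residueSet (C : ℕ) (w : Input) : Finset ℕ :=
  ({0, 1} : Finset ℕ).filter fun r => signTest w (testIndex C w r)

/-! ### Primitive recursiveness of the simulation and of the residue test -/

open Primrec PrimrecArith

theorem primrec_expTriples : Primrec expTriples := by
  unfold expTriples
  refine list_flatMap list_range ?_
  refine (list_flatMap (f := fun p : ℕ × ℕ => List.range p.1)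
    (g := fun p j => (List.range p.1).map fun k => (p.2, j, k)) (list_range.comp fst) ?_).to₂
  refine (list_map (f := fun p : (ℕ × ℕ) × ℕ => List.range p.1.1)
    (g := fun p k => (p.1.2, p.2, k)) (list_range.comp (fst.comp fst)) ?_).to₂
  exact (Primrec.pair (snd.comp (fst.comp fst)) (Primrec.pair (snd.comp fst) snd)).to₂

theorem primrec_cubeRoot : Primrec cubeRoot :=
  nat_findGreatest Primrec.id
    (nat_le.comp (nat_pow.comp snd (const 3)) fst)

section

variable {ι : Type*} [Fintype ι] (idx : ι → ℕ)

theorem primrec_denProd : Primrec (denProd idx) :=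
  finset_prod _ fun a => (list_getD 1).comp Primrec.id (const (2 * idx a + 1))

theorem primrec_scaledEntry [DecidableEq ι] (a : ι) : Primrec fun l => scaledEntry idx l a :=
  int_mul.comp ((list_getD 0).comp Primrec.id (const (2 * idx a)))
    (finset_prod _ fun b => (list_getD 1).comp Primrec.id (const (2 * idx b + 1)))

end

theorem primrec_scaledOrbit : Primrec₂ scaledOrbit := by
  refine (nat_iterate (f := fun p : Input × ℕ => p.2)
    (g := fun p => scaledEntry vecIdx p.1.2.1)
    (h := fun p x => scaledMat p.1.1 *ᵥ x) snd ?_ ?_).to₂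
  -- A map into `Fin 3 → ℤ` is treated coordinatewise: the finite index is swapped to the front and
  -- then fixed.
  · refine fin_curry.2 ((fin_curry₁.2 fun i => ?_ : Primrec₂ fun (i : Fin 3) (p : Input × ℕ) =>
      scaledEntry vecIdx p.1.2.1 i).swap)
    exact (primrec_scaledEntry vecIdx i).comp (fst.comp (snd.comp fst))
  · refine fin_curry.2 ((fin_curry₁.2 fun i => ?_ : Primrec₂ fun (i : Fin 3)
      (p : (Input × ℕ) × (Fin 3 → ℤ)) => (scaledMat p.1.1.1 *ᵥ p.2) i).swap)
    refine (finset_sum Finset.univ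
      (f := fun j (p : (Input × ℕ) × (Fin 3 → ℤ)) => scaledEntry matIdx p.1.1.1 (i, j) * p.2 j)
      fun j => ?_).of_eq fun p => rfl
    exact int_mul.comp ((primrec_scaledEntry matIdx (i, j)).comp (fst.comp (fst.comp fst)))
      (fin_app.comp snd (const j))

theorem primrec_scaledDen : Primrec₂ scaledDen :=
  int_mul.comp ((primrec_denProd vecIdx).comp (fst.comp (snd.comp fst)))
    (int_pow ((primrec_denProd matIdx).comp (fst.comp fst)) snd)

theorem primrec_scaledValue : Primrec₂ scaledValue := by
  have hlen : Primrec fun p : Input × ℕ => p.1.2.2.1.length :=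
    list_length.comp (fst.comp (snd.comp (snd.comp fst)))
  have hroot : Primrec fun p : Input × ℕ => cubeRoot p.1.2.2.1.length :=
    primrec_cubeRoot.comp hlen
  refine (list_sum_int (f := fun p : Input × ℕ =>
    (List.range p.1.2.2.1.length).map fun t => p.1.2.2.1.getD t 0 *
      homMonomial (3 * (cubeRoot p.1.2.2.1.length - 1)) (scaledOrbit p.1 p.2) (scaledDen p.1 p.2)
        ((expTriples (cubeRoot p.1.2.2.1.length)).getD t (0, 0, 0)))
    (list_map (list_range.comp hlen) ?_)).to₂
  have he : Primrec fun p : (Input × ℕ) × ℕ =>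
      (expTriples (cubeRoot p.1.1.2.2.1.length)).getD p.2 (0, 0, 0) :=
    (list_getD (0, 0, 0)).comp (primrec_expTriples.comp (hroot.comp fst)) snd
  have hx : ∀ i : Fin 3, Primrec fun p : (Input × ℕ) × ℕ => scaledOrbit p.1.1 p.1.2 i := fun i =>
    fin_app.comp (primrec_scaledOrbit.comp (fst.comp fst) (snd.comp fst)) (const i)
  have hl : Primrec fun p : (Input × ℕ) × ℕ => p.1.1.2.2.1 :=
    fst.comp (snd.comp (snd.comp (fst.comp fst)))
  have hm : Primrec fun p : (Input × ℕ) × ℕ =>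
      homMonomial (3 * (cubeRoot p.1.1.2.2.1.length - 1)) (scaledOrbit p.1.1 p.1.2)
        (scaledDen p.1.1 p.1.2) ((expTriples (cubeRoot p.1.1.2.2.1.length)).getD p.2 (0, 0, 0)) := by
    refine int_mul.comp (int_mul.comp (int_mul.comp (int_pow (hx 0) (fst.comp he))
      (int_pow (hx 1) (fst.comp (snd.comp he)))) (int_pow (hx 2) (snd.comp (snd.comp he))))
      (int_pow (primrec_scaledDen.comp (fst.comp fst) (snd.comp fst)) ?_)
    exact nat_sub.comp (nat_sub.comp (nat_sub.comp (nat_mul.comp (const 3)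
      (nat_sub.comp (hroot.comp fst) (const 1))) (fst.comp he)) (fst.comp (snd.comp he)))
      (snd.comp (snd.comp he))
  exact (int_mul.comp ((list_getD 0).comp hl snd) hm).to₂

theorem primrec_signTest : PrimrecRel signTest := by
  have hs : PrimrecPred fun p : Input × ℕ => p.1.2.2.2 = true :=
    Primrec.eq.comp (snd.comp (snd.comp (snd.comp fst))) (const true)
  refine ((hs.and (int_pos.comp primrec_scaledValue)).or
    (hs.not.and (int_nonneg.comp primrec_scaledValue))).of_eq fun p => ?_
  unfold signTest
  split_ifs with h <;> simp [h]

theorem primrec_crudeSize : Primrec crudeSize := by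
  refine list_sum_nat (list_map (list_append.comp (list_append.comp fst (fst.comp snd))
    (fst.comp (snd.comp snd))) ?_)
  exact (nat_add.comp (const 1) (int_natAbs.comp snd)).to₂

theorem primrec_testIndex (C : ℕ) : Primrec₂ (testIndex C) := by
  refine nat_add.comp (nat_add.comp (nat_mul.comp (const 2) (nat_pow.comp (const 2)
    (nat_pow.comp (primrec_crudeSize.comp fst) (const C)))) (const 2)) snd

/-- There is no search: membership is a single sign test at a primitive recursive index, although
the set itself is defined by a classical filter. -/
theorem computable_residueSet (C : ℕ) :
    ComputablePred fun q : Input × ℕ => q.2 ∈ residueSet C q.1 := by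
  have h : PrimrecPred fun q : Input × ℕ => q.2 ∈ residueSet C q.1 := by
    refine (((Primrec.eq.comp snd (const 0)).or (Primrec.eq.comp snd (const 1))).and
      (primrec_signTest.comp fst (primrec_testIndex C))).of_eq fun q => ?_
    simp [residueSet]
  obtain ⟨d, hd⟩ := h
  exact ⟨d, hd.to_comp⟩

end OrbitLDS

/-! ### A lower bound for polynomial expressions in the roots of an integer cubic -/

namespace OrbitLDS

open MvPolynomial

/-- The numbers `α 0, α 1, α 2` are the roots of a monic cubic with integer coefficients. -/
def IntegralTriple (α : Fin 3 → ℝ) : Prop :=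
  ∃ χ : Polynomial ℤ,
    χ.map (Int.castRingHom ℝ) = ∏ i, (Polynomial.X - Polynomial.C (α i))

/-- Vieta: up to sign these are the coefficients of the integer cubic. -/
theorem IntegralTriple.aeval_esymm {α : Fin 3 → ℝ} (hα : IntegralTriple α) (k : ℕ) (hk : k ≤ 3) :
    ∃ z : ℤ, aeval α (esymm (Fin 3) ℤ k) = (z : ℝ) := by
  obtain ⟨χ, hχ⟩ := hα
  have h := Multiset.prod_X_sub_C_coeff (Finset.univ.val.map α) (k := 3 - k) (by simp)
  have e : (Multiset.map (fun t => Polynomial.X - Polynomial.C t)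
      (Finset.univ.val.map α)).prod = χ.map (Int.castRingHom ℝ) := by
    rw [hχ, Multiset.map_map]; rfl
  rw [e, Polynomial.coeff_map] at h
  have h3 : (Finset.univ.val.map α).card - (3 - k) = k := by simp; omega
  rw [h3] at h
  refine ⟨(-1) ^ k * χ.coeff (3 - k), ?_⟩
  rw [aeval_esymm_eq_multiset_esymm]
  push_cast
  rw [show ((χ.coeff (3 - k) : ℤ) : ℝ) = _ from h, ← mul_assoc, ← mul_pow]
  norm_num

theorem IntegralTriple.aeval_symmetric {α : Fin 3 → ℝ} (hα : IntegralTriple α)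
    {G : MvPolynomial (Fin 3) ℤ} (hG : G.IsSymmetric) : ∃ z : ℤ, aeval α G = (z : ℝ) := by
  obtain ⟨P, hP⟩ := esymmAlgHom_fin_surjective ℤ (n := 3) (m := 3) le_rfl ⟨G, hG⟩
  have hP' : aeval (fun i : Fin 3 => esymm (Fin 3) ℤ (i + 1)) P = G := by
    rw [← esymmAlgHom_apply, hP]
  choose z hz using fun i : Fin 3 => hα.aeval_esymm (i + 1) (by omega)
  refine ⟨aeval z P, ?_⟩
  rw [← hP', ← AlgHom.comp_apply, comp_aeval]
  simp_rw [hz]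
  have := (aeval_algebraMap_apply (A := ℤ) ℝ z P)
  simpa [Function.comp_def] using this

/-- `x` is an integer polynomial in the `α i` all of whose conjugates are bounded by `B`. -/
def ConjBounded (α : Fin 3 → ℝ) (x B : ℝ) : Prop :=
  ∃ F : MvPolynomial (Fin 3) ℤ, aeval α F = x ∧
    ∀ σ : Equiv.Perm (Fin 3), |aeval (α ∘ σ) F| ≤ B

namespace ConjBounded

variable {α : Fin 3 → ℝ} {x y B B' : ℝ}

theorem abs_le (h : ConjBounded α x B) : |x| ≤ B := by
  obtain ⟨F, rfl, h⟩ := h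
  simpa using h 1

theorem nonneg (h : ConjBounded α x B) : 0 ≤ B := (abs_nonneg x).trans h.abs_le

theorem mono (h : ConjBounded α x B) (hB : B ≤ B') : ConjBounded α x B' := by
  obtain ⟨F, rfl, h⟩ := h
  exact ⟨F, rfl, fun σ => (h σ).trans hB⟩

theorem int (z : ℤ) : ConjBounded α z |(z : ℝ)| := ⟨C z, by simp, fun σ => by simp⟩

theorem root (hB : ∀ i, |α i| ≤ B) (i : Fin 3) : ConjBounded α (α i) B :=
  ⟨X i, by simp, fun σ => by simpa using hB (σ i)⟩

theorem add (hx : ConjBounded α x B) (hy : ConjBounded α y B') :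
    ConjBounded α (x + y) (B + B') := by
  obtain ⟨F, rfl, hF⟩ := hx
  obtain ⟨G, rfl, hG⟩ := hy
  refine ⟨F + G, by simp, fun σ => ?_⟩
  rw [map_add]
  exact (abs_add_le _ _).trans (add_le_add (hF σ) (hG σ))

theorem neg (hx : ConjBounded α x B) : ConjBounded α (-x) B := by
  obtain ⟨F, rfl, hF⟩ := hx
  exact ⟨-F, by simp, fun σ => by simpa using hF σ⟩

theorem sub (hx : ConjBounded α x B) (hy : ConjBounded α y B') :
    ConjBounded α (x - y) (B + B') := sub_eq_add_neg x y ▸ hx.add hy.neg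

theorem mul (hx : ConjBounded α x B) (hy : ConjBounded α y B') :
    ConjBounded α (x * y) (B * B') := by
  have hB := hx.nonneg
  obtain ⟨F, rfl, hF⟩ := hx
  obtain ⟨G, rfl, hG⟩ := hy
  refine ⟨F * G, by simp, fun σ => ?_⟩
  rw [map_mul, abs_mul]
  exact mul_le_mul (hF σ) (hG σ) (abs_nonneg _) hB

theorem one : ConjBounded α 1 1 := by simpa using int (α := α) 1

theorem zero : ConjBounded α 0 0 := by simpa using int (α := α) 0

theorem pow (hx : ConjBounded α x B) (n : ℕ) : ConjBounded α (x ^ n) (B ^ n) := by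
  induction n with
  | zero => simpa using one
  | succ n ih => rw [pow_succ, pow_succ]; exact ih.mul hx

theorem sum {ι : Type*} (s : Finset ι) {f b : ι → ℝ} (h : ∀ i ∈ s, ConjBounded α (f i) (b i)) :
    ConjBounded α (∑ i ∈ s, f i) (∑ i ∈ s, b i) := by
  classical
  induction s using Finset.induction_on with
  | empty => simpa using zero
  | insert i s hi ih =>
    rw [Finset.sum_insert hi, Finset.sum_insert hi]
    exact (h i (by simp)).add (ih fun j hj => h j (by simp [hj]))

/-- The product of the nonzero conjugates of an integer polynomial in the `α i` is an integer. -/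
theorem prod_conj_int (hα : IntegralTriple α) (F : MvPolynomial (Fin 3) ℤ) :
    ∃ z : ℤ, ∏ σ ∈ Finset.univ.filter fun σ : Equiv.Perm (Fin 3) => aeval (α ∘ σ) F ≠ 0,
      aeval (α ∘ σ) F = (z : ℝ) := by
  classical
  set s := Finset.univ.filter fun σ : Equiv.Perm (Fin 3) => aeval (α ∘ σ) F ≠ 0 with hs
  -- The coefficients of `P` are symmetric, hence integers at `α`. A formal conjugate may vanish
  -- even when `x ≠ 0`, since not every permutation need come from a field automorphism. Each
  -- vanishing one contributes a factor `X`, so the product of the others is the coefficient of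
  -- degree `sᶜ.card`.
  set P : Polynomial (MvPolynomial (Fin 3) ℤ) :=
    ∏ σ : Equiv.Perm (Fin 3), (Polynomial.X + Polynomial.C (rename σ F)) with hP
  have hsymm : ∀ k, (P.coeff k).IsSymmetric := by
    intro k τ
    have : P.map (rename τ : MvPolynomial (Fin 3) ℤ →ₐ[ℤ] _).toRingHom = P := by
      rw [hP, Polynomial.map_prod]
      refine Fintype.prod_equiv (Equiv.mulLeft τ) _ _ fun σ => ?_
      simp [rename_rename, Equiv.Perm.coe_mul]
    conv_rhs => rw [← this]
    rw [Polynomial.coeff_map]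
    rfl
  obtain ⟨z, hz⟩ := hα.aeval_symmetric (hsymm (sᶜ.card))
  refine ⟨z, ?_⟩
  rw [← hz]
  have hmap : P.map (aeval α : MvPolynomial (Fin 3) ℤ →ₐ[ℤ] ℝ).toRingHom =
      (∏ σ ∈ s, (Polynomial.X + Polynomial.C (aeval (α ∘ σ) F))) * Polynomial.X ^ sᶜ.card := by
    rw [hP, Polynomial.map_prod, ← Finset.prod_mul_prod_compl s]
    congr 1
    · refine Finset.prod_congr rfl fun σ _ => ?_
      simp [aeval_rename]
    · rw [← Finset.prod_const]
      refine Finset.prod_congr rfl fun σ hσ => ?_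
      have : aeval (α ∘ σ) F = 0 := by simpa [hs] using hσ
      simp [aeval_rename, this]
  have hc := congrArg (fun p => Polynomial.coeff p sᶜ.card) hmap
  simp only [Polynomial.coeff_map, Polynomial.coeff_mul_X_pow', le_refl, if_true, Nat.sub_self,
    Polynomial.coeff_zero_prod, Polynomial.coeff_add, Polynomial.coeff_X_zero,
    Polynomial.coeff_C_zero, zero_add] at hc
  exact hc.symm

/-- The nonzero integer from `prod_conj_int` has absolute value at least 1, and besides `|x|` it has
at most `3! - 1 = 5` factors, each at most `B`. -/
theorem one_le_abs_mul (hα : IntegralTriple α) (h : ConjBounded α x B) (hB : 1 ≤ B)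
    (hx : x ≠ 0) : 1 ≤ |x| * B ^ 5 := by
  classical
  obtain ⟨F, rfl, hF⟩ := h
  obtain ⟨z, hz⟩ := prod_conj_int hα F
  set s := Finset.univ.filter fun σ : Equiv.Perm (Fin 3) => aeval (α ∘ σ) F ≠ 0 with hs
  have h1 : (1 : Equiv.Perm (Fin 3)) ∈ s := by simpa [hs] using hx
  have hz0 : z ≠ 0 := by
    rintro rfl
    rw [Int.cast_zero, Finset.prod_eq_zero_iff] at hz
    obtain ⟨σ, hσ, h0⟩ := hz
    exact (Finset.mem_filter.1 hσ).2 h0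
  have hz1 : (1 : ℝ) ≤ |(z : ℝ)| := by exact_mod_cast Int.one_le_abs hz0
  rw [← hz, ← Finset.mul_prod_erase s _ h1, abs_mul, Finset.abs_prod] at hz1
  refine hz1.trans ?_
  refine mul_le_mul (by simp) ?_ (Finset.prod_nonneg fun _ _ => abs_nonneg _) (abs_nonneg _)
  calc ∏ σ ∈ s.erase 1, |aeval (α ∘ σ) F| ≤ ∏ _σ ∈ s.erase 1, B :=
        Finset.prod_le_prod (fun _ _ => abs_nonneg _) fun σ _ => hF σ
    _ = B ^ (s.erase 1).card := by rw [Finset.prod_const]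
    _ ≤ B ^ 5 := by
        refine pow_le_pow_right₀ hB ?_
        rw [Finset.card_erase_of_mem h1]
        have : s.card ≤ 6 := (Finset.card_le_univ s).trans (by decide)
        omega

end ConjBounded

end OrbitLDS

/-! ### The eventual sign of an exponential polynomial -/

namespace OrbitLDS

open Finset

/-- Here `(1 - 1/K)^k ≤ exp (-k/K)`, while `exp (k/K)` exceeds its Taylor term of degree `e + 1`.
That degree leaves a spare factor `k`, which absorbs all the constants. -/
theorem pow_mul_one_sub_inv_pow_le {K : ℝ} (hK : 1 ≤ K) (e : ℕ) {n k : ℕ} (hn : n ≤ 3 * k)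
    (hk : 3 ^ e * (e + 1).factorial * K ^ (e + 3) < k) :
    (n : ℝ) ^ e * (1 - 1 / K) ^ k * K ^ 2 ≤ 1 := by
  have hK0 : 0 < K := by linarith
  have hk0 : (0 : ℝ) < k := lt_of_le_of_lt (by positivity) hk
  have h1 : (1 - 1 / K) ^ k ≤ Real.exp (-(k / K)) := by
    have : 1 - 1 / K ≤ Real.exp (-(1 / K)) := by
      have := Real.add_one_le_exp (-(1 / K)); linarith
    calc (1 - 1 / K) ^ k ≤ Real.exp (-(1 / K)) ^ k :=
          pow_le_pow_left₀ (by
            have : 1 / K ≤ 1 := by rw [div_le_one hK0]; exact hK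
            linarith) this k
      _ = Real.exp (-(k / K)) := by rw [← Real.exp_nat_mul]; congr 1; ring
  have h2 : (k / K) ^ (e + 1) / (e + 1).factorial ≤ Real.exp (k / K) :=
    Real.pow_div_factorial_le_exp _ (by positivity) _
  have h3 : (n : ℝ) ^ e ≤ 3 ^ e * (k : ℝ) ^ e := by
    rw [← mul_pow]
    exact pow_le_pow_left₀ (by positivity) (by exact_mod_cast hn) e
  have h4 : (n : ℝ) ^ e * K ^ 2 ≤ Real.exp (k / K) := by
    refine le_trans ?_ h2
    rw [div_pow, div_div, le_div_iff₀ (by positivity)]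
    calc (n : ℝ) ^ e * K ^ 2 * (K ^ (e + 1) * (e + 1).factorial)
        ≤ (3 ^ e * (k : ℝ) ^ e) * K ^ 2 * (K ^ (e + 1) * (e + 1).factorial) := by gcongr
      _ = (k : ℝ) ^ e * (3 ^ e * (e + 1).factorial * K ^ (e + 3)) := by ring
      _ ≤ (k : ℝ) ^ e * k := by gcongr
      _ = (k : ℝ) ^ (e + 1) := by ring
  calc (n : ℝ) ^ e * (1 - 1 / K) ^ k * K ^ 2 = ((n : ℝ) ^ e * K ^ 2) * (1 - 1 / K) ^ k := by ring
    _ ≤ Real.exp (k / K) * Real.exp (-(k / K)) := by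
        refine mul_le_mul h4 h1 ?_ (Real.exp_pos _).le
        refine pow_nonneg ?_ _
        have : 1 / K ≤ 1 := by rw [div_le_one hK0]; exact hK
        linarith
    _ = 1 := by rw [← Real.exp_add]; simp

/-- A real exponential polynomial with nonnegative bases, gaps between its bases, and collected
coefficients bounded from below, has an explicitly bounded point after which its sign is fixed. -/
theorem exists_sign_eventually {ι : Type*} [Fintype ι] (c Λ : ι → ℝ) (m : ι → ℕ) {K : ℝ} (e : ℕ)
    {r : ℕ} (hr : r ≤ 1) (hK : 1 ≤ K) (hΛ : ∀ t, 0 ≤ Λ t) (hc : ∑ t, |c t| ≤ K)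
    (hm : ∀ t, m t ≤ e) (hgap : ∀ s t, Λ s < Λ t → Λ s ≤ Λ t * (1 - 1 / K))
    (hcoef : ∀ (x : ℝ) (j : ℕ), ∑ t with Λ t = x ∧ m t = j, c t ≠ 0 →
      1 / K ≤ |∑ t with Λ t = x ∧ m t = j, c t|) :
    ∃ ε : SignType, ∀ k : ℕ, 3 ^ e * (e + 1).factorial * K ^ (e + 3) < (k : ℝ) →
      SignType.sign (∑ t, c t * ((2 * k + r : ℕ) : ℝ) ^ m t * Λ t ^ k) = ε := by
  classical
  have hK0 : 0 < K := by linarith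
  -- The lexicographic order on (base, degree) is the order of asymptotic growth.
  set key : ι → ℝ ×ₗ ℕ := fun t => toLex (Λ t, m t) with hkey
  set g : ℝ ×ₗ ℕ → ℝ := fun κ => ∑ t with Λ t = (ofLex κ).1 ∧ m t = (ofLex κ).2, c t with hg
  have hfib : ∀ κ : ℝ ×ₗ ℕ, univ.filter (fun t => key t = κ) =
      univ.filter fun t => Λ t = (ofLex κ).1 ∧ m t = (ofLex κ).2 := by
    intro κ
    ext t
    simp only [hkey, mem_filter, mem_univ, true_and]
    constructor
    · rintro rfl; simp
    · rintro ⟨h1, h2⟩; rw [h1, h2]; rfl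
  -- Groups with base 0 vanish for `k > 0`, and groups whose coefficients cancel contribute nothing;
  -- what remains has a genuine leading term.
  set S : Finset (ℝ ×ₗ ℕ) := (univ.image key).filter fun κ => 0 < (ofLex κ).1 ∧ g κ ≠ 0 with hS
  set T : ℕ → ℝ ×ₗ ℕ → ℝ := fun k κ => ((2 * k + r : ℕ) : ℝ) ^ (ofLex κ).2 * (ofLex κ).1 ^ k with hT
  have hsum : ∀ k : ℕ, 0 < k → ∑ t, c t * ((2 * k + r : ℕ) : ℝ) ^ m t * Λ t ^ k =
      ∑ κ ∈ S, g κ * T k κ := by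
    intro k hk
    rw [hS, sum_filter_of_ne]
    · rw [← sum_fiberwise_of_maps_to (g := key) (t := univ.image key)
        (fun t _ => mem_image_of_mem _ (mem_univ t))]
      refine sum_congr rfl fun κ _ => ?_
      rw [hfib, hg, sum_mul]
      refine sum_congr rfl fun t ht => ?_
      obtain ⟨h1, h2⟩ := (mem_filter.1 ht).2
      simp only [hT]
      rw [← h1, ← h2, mul_assoc]
    · intro κ hκ hne
      obtain ⟨t, -, rfl⟩ := mem_image.1 hκ
      refine ⟨lt_of_le_of_ne (hΛ t) fun h0 => hne ?_, left_ne_zero_of_mul hne⟩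
      have : (ofLex (key t)).1 = 0 := h0.symm
      simp only [hT]
      rw [this, zero_pow hk.ne', mul_zero, mul_zero]
  have hgK : ∑ κ ∈ S, |g κ| ≤ K := by
    refine le_trans ?_ hc
    rw [← sum_fiberwise_of_maps_to (g := key) (t := univ.image key) (f := fun t => |c t|)
        (fun t _ => mem_image_of_mem _ (mem_univ t))]
    refine (sum_le_sum_of_subset_of_nonneg (filter_subset _ _)
      fun _ _ _ => abs_nonneg _).trans (sum_le_sum fun κ _ => ?_)
    rw [hfib]
    exact abs_sum_le_sum_abs _ _
  rcases S.eq_empty_or_nonempty with hS0 | hSne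
  · refine ⟨0, fun k hk => ?_⟩
    have hk0 : 0 < k := by
      have : (0 : ℝ) < k := lt_of_le_of_lt (by positivity) hk
      exact_mod_cast this
    rw [hsum k hk0, hS0, sum_empty, sign_zero]
  · set κ₀ := S.max' hSne with hκ₀
    have hmem : κ₀ ∈ S := S.max'_mem hSne
    have hpos₀ : 0 < (ofLex κ₀).1 := (mem_filter.1 hmem).2.1
    have hg₀ : 1 / K ≤ |g κ₀| := hcoef _ _ (mem_filter.1 hmem).2.2
    refine ⟨SignType.sign (g κ₀), fun k hk => ?_⟩
    have hk0 : 0 < k := by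
      have : (0 : ℝ) < k := lt_of_le_of_lt (by positivity) hk
      exact_mod_cast this
    have hn1 : (1 : ℝ) ≤ ((2 * k + r : ℕ) : ℝ) := by exact_mod_cast (by omega : 1 ≤ 2 * k + r)
    have hK2 : K ^ 2 ≤ ((2 * k + r : ℕ) : ℝ) := by
      have h1 : (k : ℝ) ≤ ((2 * k + r : ℕ) : ℝ) := by exact_mod_cast (by omega : k ≤ 2 * k + r)
      refine le_trans ?_ (hk.le.trans h1)
      have h2 : (1 : ℝ) ≤ 3 ^ e * (e + 1).factorial := by
        have : 1 ≤ 3 ^ e * (e + 1).factorial :=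
          Nat.one_le_iff_ne_zero.2 (mul_ne_zero (by positivity) (Nat.factorial_ne_zero _))
        exact_mod_cast this
      calc K ^ 2 ≤ K ^ (e + 3) := pow_le_pow_right₀ hK (by omega)
        _ ≤ _ := le_mul_of_one_le_left (by positivity) h2
    have hT0 : 0 < T k κ₀ := by
      simp only [hT]
      exact mul_pos (pow_pos (by linarith) _) (pow_pos hpos₀ _)
    have hdom : ∀ κ ∈ S.erase κ₀, T k κ * K ^ 2 ≤ T k κ₀ := by
      intro κ hκ
      obtain ⟨hne, hκS⟩ := mem_erase.1 hκ
      have hlt : κ < κ₀ := lt_of_le_of_ne (S.le_max' κ hκS) hne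
      obtain ⟨t₀, -, ht₀⟩ := mem_image.1 (mem_filter.1 hmem).1
      obtain ⟨t, -, ht⟩ := mem_image.1 (mem_filter.1 hκS).1
      have hpos : 0 < (ofLex κ).1 := (mem_filter.1 hκS).2.1
      -- A smaller base loses geometrically by the gap. An equal base has smaller degree and loses a
      -- factor `2k + r ≥ K²`.
      rcases (Prod.Lex.lt_iff).1 hlt with h | ⟨h, h'⟩
      · have hg' : (ofLex κ).1 ≤ (ofLex κ₀).1 * (1 - 1 / K) := by
          have := hgap t t₀
          rw [← ht, ← ht₀] at h ⊢
          exact this h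
        have he : (ofLex κ).2 ≤ e := by rw [← ht]; exact hm t
        have hP := pow_mul_one_sub_inv_pow_le hK e (n := 2 * k + r) (by omega) hk
        simp only [hT]
        calc ((2 * k + r : ℕ) : ℝ) ^ (ofLex κ).2 * (ofLex κ).1 ^ k * K ^ 2
            ≤ ((2 * k + r : ℕ) : ℝ) ^ e * ((ofLex κ₀).1 * (1 - 1 / K)) ^ k * K ^ 2 := by
              gcongr
          _ = (((2 * k + r : ℕ) : ℝ) ^ e * (1 - 1 / K) ^ k * K ^ 2) * (ofLex κ₀).1 ^ k := by
              rw [mul_pow]; ring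
          _ ≤ 1 * (ofLex κ₀).1 ^ k := by gcongr
          _ ≤ _ := by gcongr; exact one_le_pow₀ hn1
      · simp only [hT]
        rw [h]
        calc ((2 * k + r : ℕ) : ℝ) ^ (ofLex κ).2 * (ofLex κ₀).1 ^ k * K ^ 2
            ≤ ((2 * k + r : ℕ) : ℝ) ^ (ofLex κ).2 * (ofLex κ₀).1 ^ k * ((2 * k + r : ℕ) : ℝ) := by
              gcongr
          _ = ((2 * k + r : ℕ) : ℝ) ^ ((ofLex κ).2 + 1) * (ofLex κ₀).1 ^ k := by ring
          _ ≤ _ := by gcongr; exact h'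
    rw [hsum k hk0, ← add_sum_erase S _ hmem]
    set R := ∑ κ ∈ S.erase κ₀, g κ * T k κ with hR
    have hRb : |R| * K ^ 2 ≤ (K - |g κ₀|) * T k κ₀ := by
      have h1 : |R| ≤ ∑ κ ∈ S.erase κ₀, |g κ| * T k κ := by
        refine (abs_sum_le_sum_abs _ _).trans (sum_le_sum fun κ hκ => ?_)
        have hpos : 0 < (ofLex κ).1 := (mem_filter.1 (mem_erase.1 hκ).2).2.1
        rw [abs_mul, abs_of_nonneg (a := T k κ)]
        simp only [hT]
        positivity
      calc |R| * K ^ 2 ≤ (∑ κ ∈ S.erase κ₀, |g κ| * T k κ) * K ^ 2 := by gcongr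
        _ = ∑ κ ∈ S.erase κ₀, |g κ| * (T k κ * K ^ 2) := by
            rw [sum_mul]; exact sum_congr rfl fun _ _ => by ring
        _ ≤ ∑ κ ∈ S.erase κ₀, |g κ| * T k κ₀ :=
            sum_le_sum fun κ hκ => mul_le_mul_of_nonneg_left (hdom κ hκ) (abs_nonneg _)
        _ = (∑ κ ∈ S.erase κ₀, |g κ|) * T k κ₀ := by rw [sum_mul]
        _ ≤ _ := by
            gcongr
            rw [← add_sum_erase S _ hmem] at hgK
            linarith
    -- Otherwise `|g κ₀| K² ≤ K - |g κ₀|`, against `|g κ₀| K ≥ 1`.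
    have hRlt : |R| < |g κ₀| * T k κ₀ := by
      have h0 : 0 < |g κ₀| := lt_of_lt_of_le (by positivity) hg₀
      have h1 : 1 ≤ |g κ₀| * K := by rwa [div_le_iff₀ hK0] at hg₀
      by_contra! hcon
      have h2 : |g κ₀| * T k κ₀ * K ^ 2 ≤ (K - |g κ₀|) * T k κ₀ :=
        (mul_le_mul_of_nonneg_right hcon (by positivity)).trans hRb
      have h3 : |g κ₀| * K ^ 2 ≤ K - |g κ₀| := by
        refine le_of_mul_le_mul_right ?_ hT0
        linarith
      nlinarith
    rcases lt_or_gt_of_ne (mem_filter.1 hmem).2.2 with hneg | hpos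
    · rw [sign_neg hneg, sign_neg]
      rw [abs_of_neg hneg] at hRlt
      have := le_abs_self R
      linarith
    · rw [sign_pos hpos, sign_pos]
      rw [abs_of_pos hpos] at hRlt
      have := neg_abs_le R
      linarith

/-- `f` is an exponential polynomial of degree at most `d` in a class of building blocks with
bases bounded by `H`, with total coefficient bound `B`. -/
def ExpPoly (α : Fin 3 → ℝ) (H : ℝ) (d : ℕ) (B : ℝ) (f : ℕ → ℝ) : Prop :=
  ∃ (ι : Type) (_ : Fintype ι) (c b base : ι → ℝ) (m : ι → ℕ),
    (∀ n : ℕ, f n = ∑ t, c t * (n : ℝ) ^ m t * base t ^ n) ∧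
    (∀ t, ConjBounded α (c t) (b t)) ∧ ∑ t, b t ≤ B ∧
    ∀ t, m t ≤ 2 * d ∧ ConjBounded α (base t) (H ^ d)

namespace ExpPoly

variable {α : Fin 3 → ℝ} {H B B' : ℝ} {d d' : ℕ} {f f' : ℕ → ℝ}

theorem nonneg (h : ExpPoly α H d B f) : 0 ≤ B := by
  obtain ⟨ι, _, c, b, base, m, -, hc, hb, -⟩ := h
  exact (sum_nonneg fun t _ => (hc t).nonneg).trans hb

theorem mono (h : ExpPoly α H d B f) (hB : B ≤ B') : ExpPoly α H d B' f := by
  obtain ⟨ι, _, c, b, base, m, hf, hc, hb, hm⟩ := h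
  exact ⟨ι, _, c, b, base, m, hf, hc, hb.trans hB, hm⟩

theorem congr (h : ExpPoly α H d B f) (hf : ∀ n, f n = f' n) : ExpPoly α H d B f' := by
  rwa [← funext hf]

theorem zero : ExpPoly α H d 0 fun _ => 0 :=
  ⟨Empty, inferInstance, Empty.elim, Empty.elim, Empty.elim, Empty.elim,
    by simp, by simp, by simp, by simp⟩

theorem const {x : ℝ} (hx : ConjBounded α x B) : ExpPoly α H 0 B fun _ => x :=
  ⟨Unit, inferInstance, fun _ => x, fun _ => B, fun _ => 1, fun _ => 0,
    by simp, fun _ => hx, by simp, fun _ => ⟨le_rfl, by simpa using ConjBounded.one⟩⟩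

/-- Jordan blocks have size at most 3, hence two powers of `n` per unit of degree. -/
theorem pow_mul_geom {x : ℝ} (hx : ConjBounded α x H) {j : ℕ} (hj : j ≤ 2) :
    ExpPoly α H 1 1 fun n => (n : ℝ) ^ j * x ^ n :=
  ⟨Unit, inferInstance, fun _ => 1, fun _ => 1, fun _ => x, fun _ => j,
    by simp, fun _ => ConjBounded.one, by simp, fun _ => ⟨by simpa using hj, by simpa using hx⟩⟩

theorem add (h : ExpPoly α H d B f) (h' : ExpPoly α H d B' f') :
    ExpPoly α H d (B + B') fun n => f n + f' n := by
  obtain ⟨ι, _, c, b, base, m, hf, hc, hb, hm⟩ := h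
  obtain ⟨ι', _, c', b', base', m', hf', hc', hb', hm'⟩ := h'
  refine ⟨ι ⊕ ι', inferInstance, Sum.elim c c', Sum.elim b b', Sum.elim base base',
    Sum.elim m m', fun n => ?_, ?_, ?_, ?_⟩
  · simp [hf, hf']
  · rintro (t | t)
    exacts [hc t, hc' t]
  · simpa using add_le_add hb hb'
  · rintro (t | t)
    exacts [hm t, hm' t]

theorem mul (h : ExpPoly α H d B f) (h' : ExpPoly α H d' B' f') :
    ExpPoly α H (d + d') (B * B') fun n => f n * f' n := by
  have hB := h.nonneg
  obtain ⟨ι, _, c, b, base, m, hf, hc, hb, hm⟩ := h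
  obtain ⟨ι', _, c', b', base', m', hf', hc', hb', hm'⟩ := h'
  refine ⟨ι × ι', inferInstance, fun t => c t.1 * c' t.2, fun t => b t.1 * b' t.2,
    fun t => base t.1 * base' t.2, fun t => m t.1 + m' t.2, fun n => ?_,
    fun t => (hc t.1).mul (hc' t.2), ?_, fun t => ⟨?_, ?_⟩⟩
  · dsimp only
    rw [hf, hf', sum_mul_sum, ← univ_product_univ, sum_product]
    refine sum_congr rfl fun s _ => sum_congr rfl fun t _ => ?_
    rw [mul_pow, pow_add]; ring
  · rw [← univ_product_univ, sum_product, ← sum_mul_sum]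
    exact mul_le_mul hb hb' (sum_nonneg fun t _ => (hc' t).nonneg) hB
  · have := (hm t.1).1
    have := (hm' t.2).1
    dsimp only; omega
  · rw [pow_add]; exact (hm t.1).2.mul (hm' t.2).2

theorem const_mul {x b : ℝ} (hx : ConjBounded α x b) (h : ExpPoly α H d B f) :
    ExpPoly α H d (b * B) fun n => x * f n := by
  simpa using (const hx).mul h

theorem pow (h : ExpPoly α H d B f) (k : ℕ) : ExpPoly α H (k * d) (B ^ k) fun n => f n ^ k := by
  induction k with
  | zero => simpa using const (H := H) (ConjBounded.one (α := α))
  | succ k ih =>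
    rw [Nat.succ_mul, pow_succ]
    exact (ih.mul h).congr fun n => (pow_succ _ _).symm

theorem list_sum {τ : Type*} (l : List τ) {F : τ → ℕ → ℝ} {b : τ → ℝ}
    (h : ∀ t ∈ l, ExpPoly α H d (b t) (F t)) :
    ExpPoly α H d (l.map b).sum fun n => (l.map fun t => F t n).sum := by
  induction l with
  | nil => simpa using zero
  | cons t l ih =>
    simp only [List.map_cons, List.sum_cons]
    exact (h t (by simp)).add (ih fun s hs => h s (by simp [hs]))

/-- The sign of an exponential polynomial over an integral triple is eventually constant on each
residue class modulo `2`. -/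
theorem exists_sign (hα : IntegralTriple α) (h : ExpPoly α H d B f) (hH : 1 ≤ H) (hB : 1 ≤ B)
    {r : ℕ} (hr : r ≤ 1) :
    ∃ ε : SignType, ∀ k : ℕ,
      3 ^ (2 * d) * (2 * d + 1).factorial * (32 * B ^ 5 * H ^ (12 * d)) ^ (2 * d + 3) < (k : ℝ) →
      SignType.sign (f (2 * k + r)) = ε := by
  classical
  obtain ⟨ι, _, c, b, base, m, hf, hc, hb, hm⟩ := h
  -- A gap `β_t² - β_s²` has conjugate bound `2 H^(2d)`; its fifth power times the bound `H^(2d)`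
  -- for `β_t²` is `32 H^(12d)`. The factor `B⁵` serves the collected coefficients, whose conjugate
  -- bound is `B H^d`.
  set K : ℝ := 32 * B ^ 5 * H ^ (12 * d) with hKdef
  have hH0 : 0 < H := by linarith
  have hB0 : 0 < B := by linarith
  have hHd : ∀ j : ℕ, 1 ≤ H ^ j := fun j => one_le_pow₀ hH
  have hK : 1 ≤ K := by
    have h1 : 1 ≤ B ^ 5 := one_le_pow₀ hB
    have h2 := hHd (12 * d)
    calc (1 : ℝ) ≤ 32 * 1 * 1 := by norm_num
      _ ≤ K := by rw [hKdef]; gcongr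
  have hK0 : 0 < K := by linarith
  -- Since `β^(2k+r) = β^r (β²)^k`, the factor `β^r` joins the coefficient and the new base `β²` is
  -- nonnegative.
  have hbase : ∀ t, ConjBounded α (base t ^ r) (H ^ d) := fun t =>
    ((hm t).2.pow r).mono (by
      interval_cases r
      · simpa using hHd d
      · simp)
  have hcb : ∀ s : Finset ι, ConjBounded α (∑ t ∈ s, c t * base t ^ r) (B * H ^ d) := by
    intro s
    refine (ConjBounded.sum s fun t _ => (hc t).mul (hbase t)).mono ?_
    rw [← sum_mul]
    gcongr
    exact (sum_le_univ_sum_of_nonneg fun t => (hc t).nonneg).trans hb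
  have hBH : 1 ≤ B * H ^ d := by nlinarith [hHd d]
  have hsumK : ∑ t, |c t * base t ^ r| ≤ K := by
    calc ∑ t, |c t * base t ^ r| ≤ ∑ t, b t * H ^ d := by
          refine sum_le_sum fun t _ => ?_
          exact ((hc t).mul (hbase t)).abs_le
      _ = (∑ t, b t) * H ^ d := by rw [sum_mul]
      _ ≤ B * H ^ d := by gcongr
      _ ≤ (32 * B ^ 5) * H ^ (12 * d) := by
          have : B ≤ B ^ 5 := le_self_pow₀ hB (by norm_num)
          gcongr
          · linarith
          · omega
  have hgap : ∀ s t, base s ^ 2 < base t ^ 2 →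
      base s ^ 2 ≤ base t ^ 2 * (1 - 1 / K) := by
    intro s t hst
    have hsq : ∀ t, ConjBounded α (base t ^ 2) (H ^ (2 * d)) := fun t => by
      rw [mul_comm, pow_mul]; exact (hm t).2.pow 2
    have hd := ((hsq t).sub (hsq s)).one_le_abs_mul hα (by linarith [hHd (2 * d)])
      (sub_ne_zero.2 hst.ne')
    have hle : base t ^ 2 ≤ H ^ (2 * d) := (le_abs_self _).trans (hsq t).abs_le
    rw [abs_of_pos (sub_pos.2 hst)] at hd
    have h32 : (H ^ (2 * d) + H ^ (2 * d)) ^ 5 * H ^ (2 * d) ≤ K := by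
      rw [hKdef]
      have e : (H ^ (2 * d) + H ^ (2 * d)) ^ 5 * H ^ (2 * d) = 32 * 1 * H ^ (12 * d) := by
        rw [← two_mul, mul_pow, ← pow_mul, mul_assoc, ← pow_add]
        norm_num
        ring_nf
      rw [e]
      gcongr
      exact one_le_pow₀ hB
    have h0 : 0 ≤ base t ^ 2 - base s ^ 2 := (sub_pos.2 hst).le
    have h1 : base t ^ 2 ≤ (base t ^ 2 - base s ^ 2) * K := by
      calc base t ^ 2 = 1 * base t ^ 2 := by ring
        _ ≤ ((base t ^ 2 - base s ^ 2) * (H ^ (2 * d) + H ^ (2 * d)) ^ 5) * H ^ (2 * d) := by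
            gcongr
        _ = (base t ^ 2 - base s ^ 2) * ((H ^ (2 * d) + H ^ (2 * d)) ^ 5 * H ^ (2 * d)) := by ring
        _ ≤ _ := by gcongr
    have h2 : base t ^ 2 / K ≤ base t ^ 2 - base s ^ 2 := by rwa [div_le_iff₀ hK0]
    have h3 : base t ^ 2 * (1 - 1 / K) = base t ^ 2 - base t ^ 2 / K := by ring
    rw [h3]
    linarith
  have hcoef : ∀ (x : ℝ) (j : ℕ), ∑ t with base t ^ 2 = x ∧ m t = j, c t * base t ^ r ≠ 0 →
      1 / K ≤ |∑ t with base t ^ 2 = x ∧ m t = j, c t * base t ^ r| := by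
    intro x j hne
    have h1 := (hcb _).one_le_abs_mul hα hBH hne
    rw [div_le_iff₀ hK0]
    refine h1.trans ?_
    gcongr
    rw [hKdef, mul_pow, ← pow_mul]
    have : B ^ 5 ≤ 32 * B ^ 5 := by nlinarith [pow_pos hB0 5]
    exact mul_le_mul this (pow_le_pow_right₀ hH (by omega)) (by positivity) (by positivity)
  obtain ⟨ε, hε⟩ := exists_sign_eventually (fun t => c t * base t ^ r) (fun t => base t ^ 2) m
    (2 * d) hr hK (fun t => sq_nonneg _) hsumK (fun t => (hm t).1) hgap hcoef
  refine ⟨ε, fun k hk => ?_⟩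
  rw [hf, ← hε k hk]
  congr 1
  refine sum_congr rfl fun t _ => ?_
  rw [pow_add, pow_mul]
  ring

end ExpPoly

end OrbitLDS

/-! ### Powers of a matrix with integral eigenvalue triple -/

namespace OrbitLDS

open Matrix

/-- The complete homogeneous polynomial of degree `n - 1` in two variables, or `0`. -/
def dividedPow₂ (x y : ℝ) : ℕ → ℝ
  | 0 => 0
  | n + 1 => y * dividedPow₂ x y n + x ^ n

/-- The complete homogeneous polynomial of degree `n - 2` in three variables, or `0`. -/
def dividedPow₃ (x y z : ℝ) : ℕ → ℝ
  | 0 => 0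
  | n + 1 => z * dividedPow₃ x y z n + dividedPow₂ x y n

/-- Newton's interpolation formula for the powers of a matrix. -/
theorem pow_mulVec_newton {A : Matrix (Fin 3) (Fin 3) ℝ} {x y z : ℝ} {s v₁ v₂ : Fin 3 → ℝ}
    (h₀ : A *ᵥ s = x • s + v₁) (h₁ : A *ᵥ v₁ = y • v₁ + v₂) (h₂ : A *ᵥ v₂ = z • v₂) (n : ℕ) :
    A ^ n *ᵥ s = x ^ n • s + dividedPow₂ x y n • v₁ + dividedPow₃ x y z n • v₂ := by
  induction n with
  | zero => simp [dividedPow₂, dividedPow₃]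
  | succ n ih =>
    rw [pow_succ', ← mulVec_mulVec, ih, mulVec_add, mulVec_add, mulVec_smul, mulVec_smul,
      mulVec_smul, h₀, h₁, h₂, dividedPow₂, dividedPow₃]
    ext i
    simp only [Pi.add_apply, Pi.smul_apply, smul_eq_mul]
    ring

/-- The sequences `dividedPow₂`, `dividedPow₃` are the divided differences of `t ↦ t ^ n`. Their
recursions survive colliding nodes; this identity and the next four give closed forms for distinct,
partly equal and equal nodes. -/
theorem dividedPow₂_mul_sub (x y : ℝ) (n : ℕ) : (x - y) * dividedPow₂ x y n = x ^ n - y ^ n := by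
  induction n with
  | zero => simp [dividedPow₂]
  | succ n ih => rw [dividedPow₂]; linear_combination y * ih

theorem dividedPow₃_mul_sub (x y z : ℝ) (n : ℕ) :
    (x - y) * (x - z) * (y - z) * dividedPow₃ x y z n =
      (y - z) * x ^ n - (x - z) * y ^ n + (x - y) * z ^ n := by
  induction n with
  | zero => simp [dividedPow₃]
  | succ n ih =>
    rw [dividedPow₃]
    linear_combination z * ih + (x - z) * (y - z) * dividedPow₂_mul_sub x y n

theorem dividedPow₂_self (x : ℝ) (n : ℕ) : dividedPow₂ x x (n + 1) = (n + 1) * x ^ n := by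
  induction n with
  | zero => simp [dividedPow₂]
  | succ n ih => rw [dividedPow₂, ih]; push_cast; ring

theorem dividedPow₃_mul_sub_sq (x z : ℝ) (n : ℕ) :
    (x - z) ^ 2 * dividedPow₃ x x z (n + 1) =
      z ^ (n + 1) - x ^ (n + 1) - (n + 1) * x ^ n * (z - x) := by
  induction n with
  | zero => simp [dividedPow₃, dividedPow₂]
  | succ n ih =>
    rw [dividedPow₃]
    push_cast
    linear_combination z * ih + (x - z) ^ 2 * dividedPow₂_self x n

theorem two_mul_dividedPow₃_self (x : ℝ) (n : ℕ) :
    2 * dividedPow₃ x x x (n + 2) = (n + 2) * (n + 1) * x ^ n := by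
  induction n with
  | zero => simp [dividedPow₃, dividedPow₂]
  | succ n ih =>
    rw [dividedPow₃]
    push_cast
    have := dividedPow₂_self x (n + 1)
    push_cast at this
    linear_combination x * ih + 2 * this

section

variable {α : Fin 3 → ℝ} {H x y : ℝ} {a b : ℕ}

theorem ConjBounded.mul_pow (hx : ConjBounded α x (H ^ a)) (hy : ConjBounded α y (H ^ b)) :
    ConjBounded α (x * y) (H ^ (a + b)) := by
  rw [pow_add]; exact hx.mul hy

theorem ConjBounded.add_pow (hH : 2 ≤ H) (hx : ConjBounded α x (H ^ a))
    (hy : ConjBounded α y (H ^ a)) : ConjBounded α (x + y) (H ^ (a + 1)) := by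
  refine (hx.add hy).mono ?_
  rw [pow_succ]
  nlinarith [pow_pos (by linarith : 0 < H) a]

theorem ConjBounded.sub_pow (hH : 2 ≤ H) (hx : ConjBounded α x (H ^ a))
    (hy : ConjBounded α y (H ^ a)) : ConjBounded α (x - y) (H ^ (a + 1)) :=
  sub_eq_add_neg x y ▸ hx.add_pow hH hy.neg

theorem ConjBounded.mono_pow (hH : 2 ≤ H) (hx : ConjBounded α x (H ^ a)) (hab : a ≤ b) :
    ConjBounded α x (H ^ b) :=
  hx.mono (pow_le_pow_right₀ (by linarith) hab)

theorem ExpPoly.add_pow {f g : ℕ → ℝ} (hH : 2 ≤ H) (hf : ExpPoly α H 1 (H ^ a) f)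
    (hg : ExpPoly α H 1 (H ^ a) g) : ExpPoly α H 1 (H ^ (a + 1)) fun n => f n + g n := by
  refine (hf.add hg).mono ?_
  rw [pow_succ]
  nlinarith [pow_pos (by linarith : 0 < H) a]

theorem ExpPoly.combine₃ {f g h : ℕ → ℝ} {x₀ x₁ x₂ : ℝ} (hH : 2 ≤ H)
    (hf : ExpPoly α H 1 (H ^ b) f) (hg : ExpPoly α H 1 (H ^ b) g) (hh : ExpPoly α H 1 (H ^ b) h)
    (h₀ : ConjBounded α x₀ (H ^ a)) (h₁ : ConjBounded α x₁ (H ^ a))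
    (h₂ : ConjBounded α x₂ (H ^ a)) :
    ExpPoly α H 1 (H ^ (a + b + 2)) fun n => x₀ * f n + x₁ * g n + x₂ * h n := by
  have key : ∀ {u : ℕ → ℝ} {z : ℝ}, ExpPoly α H 1 (H ^ b) u → ConjBounded α z (H ^ a) →
      ExpPoly α H 1 (H ^ (a + b)) fun n => z * u n := fun hu hz =>
    (ExpPoly.const_mul hz hu).mono (pow_add _ _ _).ge
  exact ((key hf h₀).add_pow hH (key hg h₁)).add_pow hH
    ((key hh h₂).mono (pow_le_pow_right₀ (by linarith) (by omega)))

/-- The coefficients in Newton's formula are exponential polynomials up to a common factor. -/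
theorem exists_newton_expPoly (hH : 2 ≤ H) (hroot : ∀ i, |α i| ≤ H)
    (hα : (α 0 ≠ α 1 ∧ α 0 ≠ α 2 ∧ α 1 ≠ α 2) ∨ α 0 = α 1) :
    ∃ W : ℝ, W ≠ 0 ∧ ConjBounded α W (H ^ 6) ∧
      ExpPoly α H 1 (H ^ 10) (fun n => W * α 0 ^ (n + 2)) ∧
      ExpPoly α H 1 (H ^ 10) (fun n => W * dividedPow₂ (α 0) (α 1) (n + 2)) ∧
      ExpPoly α H 1 (H ^ 10) (fun n => W * dividedPow₃ (α 0) (α 1) (α 2) (n + 2)) := by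
  have hr : ∀ i, ConjBounded α (α i) (H ^ 1) := fun i => by
    simpa using ConjBounded.root hroot i
  have hd : ∀ i j, ConjBounded α (α i - α j) (H ^ 2) := fun i j => (hr i).sub_pow hH (hr j)
  have h2 : ConjBounded α 2 (H ^ 1) := by
    have := ConjBounded.int (α := α) 2
    refine ConjBounded.mono (B := |((2 : ℤ) : ℝ)|) (by exact_mod_cast this) (by simpa using hH)
  have hz : ∀ k, ConjBounded α 0 (H ^ k) := fun k => ConjBounded.zero.mono (by positivity)
  have hb : ∀ i j, j ≤ 2 → ExpPoly α H 1 (H ^ 0) fun n => (n : ℝ) ^ j * α i ^ n := fun i j hj => by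
    rw [pow_zero]
    exact ExpPoly.pow_mul_geom (ConjBounded.root hroot i) hj
  rcases hα with ⟨h01, h02, h12⟩ | h01
  -- Distinct nodes: the Vandermonde product clears all denominators. The shift by 2 in the index
  -- avoids negative exponents in the confluent cases. Each exponent 10 is 8 for the constants plus
  -- 2 for summing three terms.
  · have hW : ConjBounded α ((α 0 - α 1) * (α 0 - α 2) * (α 1 - α 2)) (H ^ 6) :=
      ((hd 0 1).mul_pow (hd 0 2)).mul_pow (hd 1 2)
    refine ⟨(α 0 - α 1) * (α 0 - α 2) * (α 1 - α 2),
      mul_ne_zero (mul_ne_zero (sub_ne_zero.2 h01) (sub_ne_zero.2 h02)) (sub_ne_zero.2 h12),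
      hW, ?_, ?_, ?_⟩
    · refine ((hb 0 0 (by norm_num)).combine₃ hH (hb 1 0 (by norm_num)) (hb 2 0 (by norm_num))
        (hW.mul_pow ((hr 0).mul_pow (hr 0))) (hz _) (hz _)).congr fun n => ?_
      ring
    · have hc : ∀ i, ConjBounded α ((α 0 - α 2) * (α 1 - α 2) * (α i * α i)) (H ^ 8) := fun i =>
        (((hd 0 2).mul_pow (hd 1 2)).mul_pow ((hr i).mul_pow (hr i))).mono_pow hH (by norm_num)
      refine ((hb 0 0 (by norm_num)).combine₃ hH (hb 1 0 (by norm_num)) (hb 2 0 (by norm_num))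
        (hc 0) (hc 1).neg (hz _)).congr fun n => ?_
      linear_combination -(α 0 - α 2) * (α 1 - α 2) * dividedPow₂_mul_sub (α 0) (α 1) (n + 2)
    · have hc : ∀ i j k, ConjBounded α ((α i - α j) * (α k * α k)) (H ^ 8) := fun i j k =>
        ((hd i j).mul_pow ((hr k).mul_pow (hr k))).mono_pow hH (by norm_num)
      refine ((hb 0 0 (by norm_num)).combine₃ hH (hb 1 0 (by norm_num)) (hb 2 0 (by norm_num))
        (hc 1 2 0) (hc 0 2 1).neg (hc 0 1 2)).congr fun n => ?_
      linear_combination -dividedPow₃_mul_sub (α 0) (α 1) (α 2) (n + 2)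
  · by_cases h02 : α 0 = α 2
    · rw [← h01, ← h02]
      -- Triple node: only the 2 in `(n + 2)(n + 1)/2` must be cleared.
      refine ⟨2, two_ne_zero, h2.mono_pow hH (by norm_num), ?_, ?_, ?_⟩
      · refine ((hb 0 0 (by norm_num)).combine₃ hH (hb 0 1 (by norm_num)) (hb 0 2 (by norm_num))
          ((h2.mul_pow ((hr 0).mul_pow (hr 0))).mono_pow hH (b := 8) (by norm_num))
          (hz _) (hz _)).congr fun n => ?_
        ring
      · refine ((hb 0 0 (by norm_num)).combine₃ hH (hb 0 1 (by norm_num)) (hb 0 2 (by norm_num))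
          (((h2.mul_pow h2).mul_pow (hr 0)).mono_pow hH (b := 8) (by norm_num))
          ((h2.mul_pow (hr 0)).mono_pow hH (b := 8) (by norm_num)) (hz _)).congr fun n => ?_
        have := dividedPow₂_self (α 0) (n + 1)
        push_cast at this
        linear_combination -2 * this
      · have h1 : ConjBounded α 1 (H ^ 1) :=
          ConjBounded.one.mono (one_le_pow₀ (by linarith))
        refine ((hb 0 0 (by norm_num)).combine₃ hH (hb 0 1 (by norm_num)) (hb 0 2 (by norm_num))
          (h2.mono_pow hH (b := 8) (by norm_num))
          ((h2.add_pow hH h1).mono_pow hH (b := 8) (by norm_num))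
          (h1.mono_pow hH (by norm_num))).congr fun n => ?_
        linear_combination -two_mul_dividedPow₃_self (α 0) n
    · rw [← h01]
      have hW : ConjBounded α ((α 0 - α 2) ^ 2) (H ^ 4) := by
        rw [sq]; exact (hd 0 2).mul_pow (hd 0 2)
      refine ⟨(α 0 - α 2) ^ 2, pow_ne_zero _ (sub_ne_zero.2 h02),
        hW.mono_pow hH (by norm_num), ?_, ?_, ?_⟩
      · refine ((hb 0 0 (by norm_num)).combine₃ hH (hb 0 1 (by norm_num)) (hb 2 0 (by norm_num))
          ((hW.mul_pow ((hr 0).mul_pow (hr 0))).mono_pow hH (b := 8) (by norm_num))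
          (hz _) (hz _)).congr fun n => ?_
        ring
      · refine ((hb 0 0 (by norm_num)).combine₃ hH (hb 0 1 (by norm_num)) (hb 2 0 (by norm_num))
          ((hW.mul_pow (h2.mul_pow (hr 0))).mono_pow hH (b := 8) (by norm_num))
          ((hW.mul_pow (hr 0)).mono_pow hH (b := 8) (by norm_num)) (hz _)).congr fun n => ?_
        have := dividedPow₂_self (α 0) (n + 1)
        push_cast at this
        linear_combination -(α 0 - α 2) ^ 2 * this
      · have ha : ConjBounded α (α 0 * α 0) (H ^ 4) :=
          ((hr 0).mul_pow (hr 0)).mono_pow hH (by norm_num)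
        refine ((hb 0 0 (by norm_num)).combine₃ hH (hb 0 1 (by norm_num)) (hb 2 0 (by norm_num))
          ((((h2.mul_pow (hr 0)).mul_pow (hd 0 2)).sub_pow hH ha).mono_pow hH (b := 8)
            (by norm_num))
          (((hr 0).mul_pow (hd 0 2)).mono_pow hH (b := 8) (by norm_num))
          (((hr 2).mul_pow (hr 2)).mono_pow hH (b := 8) (by norm_num))).congr fun n => ?_
        have := dividedPow₃_mul_sub_sq (α 0) (α 2) (n + 1)
        push_cast at this
        linear_combination -this

/-- The coordinates of `A ^ (n + 2) s` are exponential polynomials up to a common factor. -/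
theorem exists_pow_mulVec_expPoly (hH : 2 ≤ H) (hroot : ∀ i, |α i| ≤ H)
    (hα : (α 0 ≠ α 1 ∧ α 0 ≠ α 2 ∧ α 1 ≠ α 2) ∨ α 0 = α 1)
    (A : Matrix (Fin 3) (Fin 3) ℤ) (s : Fin 3 → ℤ) (hA : ∀ i j, |(A i j : ℝ)| ≤ H)
    (hs : ∀ i, |(s i : ℝ)| ≤ H)
    (hCH : (A.map (Int.cast : ℤ → ℝ) - scalar (Fin 3) (α 2)) *
      (A.map (Int.cast : ℤ → ℝ) - scalar (Fin 3) (α 1)) *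
      (A.map (Int.cast : ℤ → ℝ) - scalar (Fin 3) (α 0)) = 0) :
    ∃ W : ℝ, W ≠ 0 ∧ ConjBounded α W (H ^ 6) ∧ ∀ i, ExpPoly α H 1 (H ^ 19)
      fun n => W * (((A ^ (n + 2) *ᵥ s) i : ℤ) : ℝ) := by
  obtain ⟨W, hW0, hW, h0, h1, h2⟩ := exists_newton_expPoly hH hroot hα
  refine ⟨W, hW0, hW, fun i => ?_⟩
  set A' : Matrix (Fin 3) (Fin 3) ℝ := A.map (Int.cast : ℤ → ℝ) with hA'
  set s' : Fin 3 → ℝ := fun i => (s i : ℝ) with hs'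
  set v₁ := (A' - scalar (Fin 3) (α 0)) *ᵥ s' with hv₁
  set v₂ := (A' - scalar (Fin 3) (α 1)) *ᵥ v₁ with hv₂
  have hsc : ∀ (x : ℝ) (v : Fin 3 → ℝ), (A' - scalar (Fin 3) x) *ᵥ v = A' *ᵥ v - x • v := by
    intro x v
    rw [sub_mulVec]
    congr 1
    ext i
    simp [mulVec_diagonal]
  have hr : ∀ i, ConjBounded α (α i) (H ^ 1) := fun i => by
    simpa using ConjBounded.root hroot i
  have hAc : ∀ i j, ConjBounded α (A' i j) (H ^ 1) := fun i j =>
    (ConjBounded.int (A i j)).mono (by simpa using hA i j)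
  have hstep : ∀ (k : ℕ) (v : Fin 3 → ℝ) (j : Fin 3), (∀ i, ConjBounded α (v i) (H ^ k)) →
      ∀ i, ConjBounded α (((A' - scalar (Fin 3) (α j)) *ᵥ v) i) (H ^ (k + 3)) := by
    intro k v j hv i
    rw [hsc]
    have hm : ∀ l, ConjBounded α (A' i l * v l) (H ^ (1 + k)) := fun l => (hAc i l).mul_pow (hv l)
    have : (A' *ᵥ v - α j • v) i =
        (A' i 0 * v 0 + A' i 1 * v 1) + (A' i 2 * v 2 - α j * v i) := by
      simp [mulVec, dotProduct, Fin.sum_univ_three]; ring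
    rw [this]
    exact (((hm 0).add_pow hH (hm 1)).add_pow hH
      ((hm 2).sub_pow hH ((hr j).mul_pow (hv i)))).mono_pow hH (by omega)
  have hs1 : ∀ i, ConjBounded α (s' i) (H ^ 1) := fun i =>
    (ConjBounded.int (s i)).mono (by simpa using hs i)
  -- Cayley–Hamilton makes `v₂` an eigenvector for `α 2` (or zero), so the Newton expansion stops
  -- after three terms.
  have hN := pow_mulVec_newton (A := A') (x := α 0) (y := α 1) (z := α 2) (s := s') (v₁ := v₁)
    (v₂ := v₂) (by rw [hv₁, hsc]; abel) (by rw [hv₂, hsc]; abel) (by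
      have : (A' - scalar (Fin 3) (α 2)) *ᵥ v₂ = 0 := by
        rw [hv₂, hv₁, mulVec_mulVec, mulVec_mulVec, hCH, zero_mulVec]
      rw [hsc] at this
      exact sub_eq_zero.1 this)
  have hcast : ∀ n, (((A ^ n *ᵥ s) i : ℤ) : ℝ) = (A' ^ n *ᵥ s') i := by
    intro n
    have h1 : A' ^ n = (A ^ n).map (Int.castRingHom ℝ) := by
      rw [hA']
      exact (map_pow (Int.castRingHom ℝ).mapMatrix A n).symm
    rw [h1]
    simp [mulVec, dotProduct, hs']
  -- The vectors `s'`, `v₁`, `v₂` have bounds `H`, `H⁴`, `H⁷`, and `19 = 7 + 10 + 2`.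
  refine ((h0.combine₃ hH h1 h2 ((hs1 i).mono_pow hH (b := 7) (by norm_num))
    ((hstep 1 s' 0 hs1 i).mono_pow hH (by norm_num))
    (hstep 4 v₁ 1 (hstep 1 s' 0 hs1) i)).congr fun n => ?_)
  rw [hcast, hN]
  simp only [Pi.add_apply, Pi.smul_apply, smul_eq_mul]
  ring

/-- The closed forms for divided differences require a repeated node to occupy the first two places.
-/
theorem exists_perm_sorted (α : Fin 3 → ℝ) : ∃ τ : Equiv.Perm (Fin 3),
    ((α ∘ τ) 0 ≠ (α ∘ τ) 1 ∧ (α ∘ τ) 0 ≠ (α ∘ τ) 2 ∧ (α ∘ τ) 1 ≠ (α ∘ τ) 2) ∨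
      (α ∘ τ) 0 = (α ∘ τ) 1 := by
  by_cases h01 : α 0 = α 1
  · exact ⟨1, Or.inr h01⟩
  by_cases h02 : α 0 = α 2
  · refine ⟨Equiv.swap 1 2, Or.inr ?_⟩
    simpa [Equiv.swap_apply_of_ne_of_ne] using h02
  by_cases h12 : α 1 = α 2
  · refine ⟨Equiv.swap 0 2, Or.inr ?_⟩
    simpa [Equiv.swap_apply_of_ne_of_ne] using h12.symm
  · exact ⟨1, Or.inl ⟨h01, h02, h12⟩⟩

end

end OrbitLDS

/-! ### Correctness of the simulation on instance codes -/

namespace OrbitLDS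

open Matrix

section Scaled

variable {ι : Type*} [Fintype ι] {idx : ι → ℕ} {l : List ℤ} {f : ι → ℚ}

theorem denProd_pos (hden : ∀ a, l.getD (2 * idx a + 1) 1 = (f a).den) : 0 < denProd idx l := by
  refine Finset.prod_pos fun a _ => ?_
  rw [hden]
  exact_mod_cast (f a).den_pos

theorem scaledEntry_cast [DecidableEq ι] (hnum : ∀ a, l.getD (2 * idx a) 0 = (f a).num)
    (hden : ∀ a, l.getD (2 * idx a + 1) 1 = (f a).den) (a : ι) :
    (scaledEntry idx l a : ℚ) = denProd idx l * f a := by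
  have h : denProd idx l =
      (f a).den * ∏ b ∈ Finset.univ.erase a, l.getD (2 * idx b + 1) 1 := by
    rw [denProd, ← Finset.mul_prod_erase _ _ (Finset.mem_univ a), hden]
  rw [h, scaledEntry, hnum]
  push_cast
  rw [mul_right_comm, mul_comm ((f a).den : ℚ), Rat.mul_den_eq_num]

theorem abs_denProd_le {B : ℤ} (hden : ∀ a, |l.getD (2 * idx a + 1) 1| ≤ B) :
    |denProd idx l| ≤ B ^ Fintype.card ι := by
  rw [denProd, Finset.abs_prod]
  exact (Finset.prod_le_prod (fun _ _ => abs_nonneg _) fun a _ => hden a).trans (by simp)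

theorem abs_scaledEntry_le [DecidableEq ι] {B : ℤ} (hnum : ∀ a, |l.getD (2 * idx a) 0| ≤ B)
    (hden : ∀ a, |l.getD (2 * idx a + 1) 1| ≤ B) (a : ι) :
    |scaledEntry idx l a| ≤ B ^ Fintype.card ι := by
  rw [scaledEntry, abs_mul, Finset.abs_prod]
  calc _ ≤ B * ∏ _b ∈ Finset.univ.erase a, B :=
        mul_le_mul (hnum a) (Finset.prod_le_prod (fun _ _ => abs_nonneg _) fun b _ => hden b)
          (Finset.prod_nonneg fun _ _ => abs_nonneg _) ((abs_nonneg _).trans (hnum a))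
    _ = ∏ _b : ι, B := Finset.mul_prod_erase _ (fun _ => B) (Finset.mem_univ a)
    _ = B ^ Fintype.card ι := by simp

end Scaled

section Code

variable (M : Matrix (Fin 3) (Fin 3) ℚ) (s : Fin 3 → ℚ)

theorem matCode_getD_num (p : Fin 3 × Fin 3) :
    (matCode M).getD (2 * matIdx p) 0 = (M p.1 p.2).num := by
  obtain ⟨i, j⟩ := p
  fin_cases i <;> fin_cases j <;> rfl

theorem matCode_getD_den (p : Fin 3 × Fin 3) :
    (matCode M).getD (2 * matIdx p + 1) 1 = (M p.1 p.2).den := by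
  obtain ⟨i, j⟩ := p
  fin_cases i <;> fin_cases j <;> rfl

theorem vecCode_getD_num (i : Fin 3) : (vecCode s).getD (2 * vecIdx i) 0 = (s i).num := by
  fin_cases i <;> rfl

theorem vecCode_getD_den (i : Fin 3) : (vecCode s).getD (2 * vecIdx i + 1) 1 = (s i).den := by
  fin_cases i <;> rfl

theorem scaledMat_map_rat : (scaledMat (matCode M)).map (Int.cast : ℤ → ℚ) =
    (denProd matIdx (matCode M) : ℚ) • M := by
  ext i j
  simpa [scaledMat] using scaledEntry_cast (f := fun p => M p.1 p.2) (matCode_getD_num M)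
    (matCode_getD_den M) (i, j)

end Code

theorem scaledOrbit_eq (w : Input) (n : ℕ) :
    scaledOrbit w n = scaledMat w.1 ^ n *ᵥ scaledEntry vecIdx w.2.1 := by
  induction n with
  | zero => simp [scaledOrbit]
  | succ n ih =>
    rw [scaledOrbit, Function.iterate_succ_apply', ← scaledOrbit, ih, mulVec_mulVec, pow_succ']

section Instance

variable (M : Matrix (Fin 3) (Fin 3) ℚ) (s : Fin 3 → ℚ) (T : AtomicSemialgebraic)

theorem scaledDen_pos (n : ℕ) : 0 < scaledDen (instanceCode M s T) n :=
  mul_pos (denProd_pos (vecCode_getD_den s))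
    (pow_pos (denProd_pos (f := fun p : Fin 3 × Fin 3 => M p.1 p.2) (matCode_getD_den M)) n)

theorem scaledOrbit_cast (n : ℕ) (i : Fin 3) : (scaledOrbit (instanceCode M s T) n i : ℝ) =
    scaledDen (instanceCode M s T) n * orbit M s n i := by
  have h : (scaledOrbit (instanceCode M s T) n i : ℚ) =
      scaledDen (instanceCode M s T) n * (M ^ n *ᵥ s) i := by
    rw [scaledOrbit_eq]
    change ((scaledMat (matCode M) ^ n *ᵥ scaledEntry vecIdx (vecCode s)) i : ℚ) = _
    have h1 : (scaledMat (matCode M) ^ n).map (Int.castRingHom ℚ) =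
        ((denProd matIdx (matCode M) : ℚ) • M) ^ n := by
      rw [← scaledMat_map_rat]
      exact map_pow (Int.castRingHom ℚ).mapMatrix _ n
    have h2 : (fun j => (scaledEntry vecIdx (vecCode s) j : ℚ)) =
        (denProd vecIdx (vecCode s) : ℚ) • s := by
      ext j
      exact scaledEntry_cast (vecCode_getD_num s) (vecCode_getD_den s) j
    have h3 : ((scaledMat (matCode M) ^ n *ᵥ scaledEntry vecIdx (vecCode s)) i : ℚ) =
        ((scaledMat (matCode M) ^ n).map (Int.castRingHom ℚ) *ᵥ
          fun j => (scaledEntry vecIdx (vecCode s) j : ℚ)) i := by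
      simp [mulVec, dotProduct]
    rw [h3, h1, h2, smul_pow, smul_mulVec, mulVec_smul]
    simp only [scaledDen, instanceCode, Pi.smul_apply, smul_eq_mul]
    push_cast
    ring
  rw [orbit]
  exact_mod_cast congrArg (Rat.cast : ℚ → ℝ) h

end Instance

/-- The exponent vector of a triple. -/
noncomputable def tripleExp (e : ℕ × ℕ × ℕ) : Fin 3 →₀ ℕ :=
  Finsupp.equivFunOnFinite.symm ![e.1, e.2.1, e.2.2]

theorem polyCode_eq (p : MvPolynomial (Fin 3) ℤ) :
    polyCode p = (expTriples (p.totalDegree + 1)).map fun e => p.coeff (tripleExp e) := by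
  simp only [polyCode, expTriples, List.map_flatMap, List.map_map]
  rfl

theorem length_expTriples (b : ℕ) : (expTriples b).length = b ^ 3 := by
  simp [expTriples, List.length_flatMap]
  ring

/-- The coefficient list has `(deg p + 1)³` entries, so the degree bound is recovered from its
length. -/
theorem cubeRoot_pow (b : ℕ) : cubeRoot (b ^ 3) = b := by
  have hb : b ≤ b ^ 3 := Nat.le_self_pow (by norm_num) b
  refine le_antisymm ?_ (Nat.le_findGreatest hb le_rfl)
  exact (Nat.pow_le_pow_iff_left (by norm_num)).1
    (Nat.findGreatest_spec (P := fun c => c ^ 3 ≤ b ^ 3) hb le_rfl)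

theorem sum_map_range_getD {β R : Type*} [AddCommMonoid R] (L : List β) (d : β) (G : β → R) :
    ((List.range L.length).map fun t => G (L.getD t d)).sum = (L.map G).sum := by
  congr 1
  refine List.ext_getElem (by simp) fun t h₁ h₂ => ?_
  simp only [List.length_map] at h₂
  rw [List.getElem_map, List.getElem_map, List.getElem_range, List.getD_eq_getElem _ _ h₂]

theorem scaledValue_instanceCode (M : Matrix (Fin 3) (Fin 3) ℚ) (s : Fin 3 → ℚ)
    (T : AtomicSemialgebraic) (n : ℕ) : scaledValue (instanceCode M s T) n =
      ((expTriples (T.poly.totalDegree + 1)).map fun e => T.poly.coeff (tripleExp e) *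
        homMonomial (3 * T.poly.totalDegree) (scaledOrbit (instanceCode M s T) n)
          (scaledDen (instanceCode M s T) n) e).sum := by
  have h : (instanceCode M s T).2.2.1 = polyCode T.poly := rfl
  have hl : (polyCode T.poly).length = (T.poly.totalDegree + 1) ^ 3 := by
    rw [polyCode_eq, List.length_map, length_expTriples]
  rw [scaledValue, h, hl, cubeRoot_pow, Nat.add_sub_cancel, polyCode_eq]
  rw [← sum_map_range_getD _ (0, 0, 0), length_expTriples]
  congr 1
  refine List.map_congr_left fun t ht => ?_
  have ht' : t < (expTriples (T.poly.totalDegree + 1)).length := by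
    rw [length_expTriples]; exact List.mem_range.1 ht
  rw [List.getD_eq_getElem _ _ (by simpa using ht'), List.getElem_map,
    List.getD_eq_getElem _ _ ht']

theorem mem_expTriples {b : ℕ} {e : ℕ × ℕ × ℕ} :
    e ∈ expTriples b ↔ e.1 < b ∧ e.2.1 < b ∧ e.2.2 < b := by
  obtain ⟨i, j, k⟩ := e
  simp [expTriples]

theorem sum_map_expTriples {R : Type*} [AddCommMonoid R] (b : ℕ) (G : ℕ × ℕ × ℕ → R) :
    ((expTriples b).map G).sum =
      ∑ e ∈ Finset.range b ×ˢ Finset.range b ×ˢ Finset.range b, G e := by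
  have hnd : (expTriples b).Nodup := by
    have : expTriples b = List.range b ×ˢ (List.range b ×ˢ List.range b) := by
      simp only [expTriples, SProd.sprod, List.product, List.map_flatMap, List.map_map]
      rfl
    rw [this]
    exact List.nodup_range.product (List.nodup_range.product List.nodup_range)
  rw [← List.sum_toFinset _ hnd]
  congr 1
  ext e
  simp [mem_expTriples]

theorem aeval_eq_sum_expTriples (p : MvPolynomial (Fin 3) ℤ) (x : Fin 3 → ℝ) :
    MvPolynomial.aeval x p = ((expTriples (p.totalDegree + 1)).map fun e =>
      ((p.coeff (tripleExp e) : ℤ) : ℝ) * (x 0 ^ e.1 * x 1 ^ e.2.1 * x 2 ^ e.2.2)).sum := by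
  rw [sum_map_expTriples, MvPolynomial.aeval_def, MvPolynomial.eval₂_eq']
  have hinv : ∀ m : Fin 3 →₀ ℕ, tripleExp (m 0, m 1, m 2) = m := by
    intro m
    ext i
    fin_cases i <;> rfl
  refine Finset.sum_of_injOn (fun m => (m 0, m 1, m 2)) ?_ ?_ ?_ ?_
  · intro m _ m' _ h
    rw [← hinv m, ← hinv m']
    exact congrArg tripleExp h
  · intro m hm
    have hle := MvPolynomial.le_totalDegree hm
    have h1 : ∀ i, m i ≤ m.sum fun _ e => e := fun i => by
      rw [Finsupp.sum_fintype _ _ (fun _ => rfl)]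
      exact Finset.single_le_sum (f := fun i => m i) (fun _ _ => Nat.zero_le _) (Finset.mem_univ i)
    simp only [Finset.coe_product, Finset.coe_range, Set.mem_prod, Set.mem_Iio]
    exact ⟨by have := h1 0; omega, by have := h1 1; omega, by have := h1 2; omega⟩
  · intro e _ he
    have : p.coeff (tripleExp e) = 0 := by
      by_contra hne
      exact he ⟨tripleExp e, by simpa using hne, rfl⟩
    rw [this]; simp
  · intro m _
    rw [hinv]
    simp [Fin.prod_univ_three]

/-- Homogeneity lets a single power of `w` factor out of every monomial. It serves twice: to clear
denominators and to insert the factor `W`. The degree used is `3 * deg p`, because exponents range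
over a cube and the subtraction in `homMonomial` must not truncate. -/
theorem homMonomial_smul {R : Type*} [CommRing R] {m : ℕ} (x : Fin 3 → R) (q w : R)
    {e : ℕ × ℕ × ℕ} (he : e.1 + e.2.1 + e.2.2 ≤ m) :
    homMonomial m (fun i => w * x i) (w * q) e = w ^ m * homMonomial m x q e := by
  have : w ^ m = w ^ e.1 * w ^ e.2.1 * w ^ e.2.2 * w ^ (m - e.1 - e.2.1 - e.2.2) := by
    rw [← pow_add, ← pow_add, ← pow_add]
    congr 1
    omega
  rw [homMonomial, homMonomial, this]
  simp only [mul_pow]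
  ring

theorem degree_le_of_mem_expTriples {d : ℕ} {e : ℕ × ℕ × ℕ} (he : e ∈ expTriples (d + 1)) :
    e.1 + e.2.1 + e.2.2 ≤ 3 * d := by
  have := mem_expTriples.1 he
  omega

theorem scaledValue_cast_eq_sum (M : Matrix (Fin 3) (Fin 3) ℚ) (s : Fin 3 → ℚ)
    (T : AtomicSemialgebraic) (n : ℕ) : (scaledValue (instanceCode M s T) n : ℝ) =
      ((expTriples (T.poly.totalDegree + 1)).map fun e => ((T.poly.coeff (tripleExp e) : ℤ) : ℝ) *
        homMonomial (3 * T.poly.totalDegree)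
          (fun i => (scaledOrbit (instanceCode M s T) n i : ℝ))
          (scaledDen (instanceCode M s T) n : ℝ) e).sum := by
  rw [scaledValue_instanceCode]
  change Int.castRingHom ℝ _ = _
  rw [map_list_sum, List.map_map]
  congr 2
  ext e
  simp [homMonomial]

theorem scaledValue_cast (M : Matrix (Fin 3) (Fin 3) ℚ) (s : Fin 3 → ℚ)
    (T : AtomicSemialgebraic) (n : ℕ) : (scaledValue (instanceCode M s T) n : ℝ) =
      (scaledDen (instanceCode M s T) n : ℝ) ^ (3 * T.poly.totalDegree) *
        MvPolynomial.aeval (orbit M s n) T.poly := by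
  rw [scaledValue_cast_eq_sum, aeval_eq_sum_expTriples, ← List.sum_map_mul_left]
  congr 1
  refine List.map_congr_left fun e he => ?_
  have h := homMonomial_smul (orbit M s n) 1 (scaledDen (instanceCode M s T) n : ℝ)
    (degree_le_of_mem_expTriples he)
  rw [mul_one] at h
  simp_rw [scaledOrbit_cast]
  rw [h]
  simp only [homMonomial, one_pow, mul_one]
  ring

theorem mem_toSet_iff_signTest (M : Matrix (Fin 3) (Fin 3) ℚ) (s : Fin 3 → ℚ)
    (T : AtomicSemialgebraic) (n : ℕ) :
    orbit M s n ∈ T.toSet ↔ signTest (instanceCode M s T) n := by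
  have hq : (0 : ℝ) < (scaledDen (instanceCode M s T) n : ℝ) ^ (3 * T.poly.totalDegree) :=
    pow_pos (by exact_mod_cast scaledDen_pos M s T n) _
  have h := scaledValue_cast M s T n
  have h1 : 0 < scaledValue (instanceCode M s T) n ↔
      0 < MvPolynomial.aeval (orbit M s n) T.poly := by
    rw [← Int.cast_pos (R := ℝ), h, mul_pos_iff_of_pos_left hq]
  have h2 : 0 ≤ scaledValue (instanceCode M s T) n ↔
      0 ≤ MvPolynomial.aeval (orbit M s n) T.poly := by
    rw [← Int.cast_nonneg_iff (R := ℝ), h, mul_nonneg_iff_of_pos_left hq]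
  have h3 : (instanceCode M s T).2.2.2 = T.strict := rfl
  unfold signTest AtomicSemialgebraic.toSet
  rw [Set.mem_ofPred_eq, h1, h2, h3]

end OrbitLDS

/-! ### Size bounds -/

namespace OrbitLDS

open Matrix

theorem abs_le_two_pow_bitLength (z : ℤ) : 2 * |z| ≤ 2 ^ bitLength z := by
  have h : z.natAbs < 2 ^ Nat.size z.natAbs := Nat.lt_size_self _
  rw [bitLength, add_comm, pow_succ, Int.abs_eq_natAbs]
  have : (z.natAbs : ℤ) ≤ 2 ^ Nat.size z.natAbs := by exact_mod_cast h.le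
  linarith

theorem bitLength_le_listSize {l : List ℤ} {z : ℤ} (hz : z ∈ l) : bitLength z ≤ listSize l :=
  List.le_sum_of_mem (List.mem_map_of_mem hz)

theorem length_le_listSize (l : List ℤ) : l.length ≤ listSize l := by
  induction l with
  | nil => simp
  | cons z l ih =>
    simp only [listSize, List.map_cons, List.sum_cons, List.length_cons, bitLength] at ih ⊢
    omega

theorem abs_le_two_pow_of_mem {l : List ℤ} {z : ℤ} {S : ℕ} (hz : z ∈ l) (hS : listSize l ≤ S) :
    |z| ≤ 2 ^ S := by
  have h1 : (2 : ℤ) ^ bitLength z ≤ 2 ^ S :=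
    pow_le_pow_right₀ (by norm_num) ((bitLength_le_listSize hz).trans hS)
  have := abs_le_two_pow_bitLength z
  have := abs_nonneg z
  linarith

/-- The sign bit gives `2|z| ≤ 2 ^ bitLength z`, so the head and the tail each take at most half of
the bound. -/
theorem sum_abs_le_two_pow_listSize (l : List ℤ) : (l.map fun z => |z|).sum ≤ 2 ^ listSize l := by
  induction l with
  | nil => simp
  | cons z l ih =>
    have e : listSize (z :: l) = bitLength z + listSize l := by simp [listSize]
    rw [List.map_cons, List.sum_cons, e, pow_add]
    have h1 := abs_le_two_pow_bitLength z
    have h2 : (2 : ℤ) ≤ 2 ^ bitLength z := by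
      calc (2 : ℤ) = 2 ^ 1 := by norm_num
        _ ≤ _ := pow_le_pow_right₀ (by norm_num) (by unfold bitLength; omega)
    have h3 : (1 : ℤ) ≤ 2 ^ listSize l := one_le_pow₀ (by norm_num)
    nlinarith

theorem bitLength_le (z : ℤ) : bitLength z ≤ 1 + z.natAbs :=
  Nat.add_le_add_left (Nat.size_le.2 Nat.lt_two_pow_self) 1

theorem listSize_le (l : List ℤ) : listSize l ≤ (l.map fun z => 1 + z.natAbs).sum :=
  List.sum_le_sum fun z _ => bitLength_le z

section

variable (M : Matrix (Fin 3) (Fin 3) ℚ) (s : Fin 3 → ℚ) (T : AtomicSemialgebraic)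

/-- Overestimating the size only pushes the test index further past the threshold, which does not
affect the answer. -/
theorem instanceSize_le_crudeSize : instanceSize M s T ≤ crudeSize (instanceCode M s T) := by
  rw [instanceSize, crudeSize]
  simp only [List.map_append, List.sum_append, instanceCode]
  exact add_le_add (add_le_add (listSize_le _) (listSize_le _)) (listSize_le _)

theorem length_polyCode (p : MvPolynomial (Fin 3) ℤ) :
    (polyCode p).length = (p.totalDegree + 1) ^ 3 := by
  rw [polyCode_eq, List.length_map, length_expTriples]

theorem totalDegree_lt_instanceSize : T.poly.totalDegree + 1 ≤ instanceSize M s T := by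
  have h1 := length_le_listSize (polyCode T.poly)
  rw [length_polyCode] at h1
  have h2 := Nat.le_self_pow (n := 3) (by norm_num) (T.poly.totalDegree + 1)
  unfold instanceSize
  omega

theorem twentyFive_le_instanceSize : 25 ≤ instanceSize M s T := by
  have h1 := length_le_listSize (polyCode T.poly)
  rw [length_polyCode] at h1
  have h2 := Nat.le_self_pow (n := 3) (by norm_num) (T.poly.totalDegree + 1)
  have h3 : 18 ≤ listSize (matCode M) := length_le_listSize (matCode M)
  have h4 : 6 ≤ listSize (vecCode s) := length_le_listSize (vecCode s)
  unfold instanceSize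
  omega

theorem num_mem_vecCode (i : Fin 3) : (s i).num ∈ vecCode s :=
  List.mem_flatMap.2 ⟨i, List.mem_finRange i, by simp [ratCode]⟩

theorem den_mem_vecCode (i : Fin 3) : ((s i).den : ℤ) ∈ vecCode s :=
  List.mem_flatMap.2 ⟨i, List.mem_finRange i, by simp [ratCode]⟩

theorem num_mem_matCode (i j : Fin 3) : (M i j).num ∈ matCode M :=
  List.mem_flatMap.2 ⟨i, List.mem_finRange i, num_mem_vecCode _ j⟩

theorem den_mem_matCode (i j : Fin 3) : ((M i j).den : ℤ) ∈ matCode M :=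
  List.mem_flatMap.2 ⟨i, List.mem_finRange i, den_mem_vecCode _ j⟩

theorem abs_scaledMat_le {S : ℕ} (hS : listSize (matCode M) ≤ S) (i j : Fin 3) :
    |scaledMat (matCode M) i j| ≤ 2 ^ (9 * S) := by
  have h := abs_scaledEntry_le (idx := matIdx) (l := matCode M) (B := 2 ^ S)
    (fun p => by
      rw [matCode_getD_num]; exact abs_le_two_pow_of_mem (num_mem_matCode M _ _) hS)
    (fun p => by
      rw [matCode_getD_den]; exact abs_le_two_pow_of_mem (den_mem_matCode M _ _) hS) (i, j)
  rw [← pow_mul, mul_comm] at h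
  exact h

theorem abs_denProd_matCode_le {S : ℕ} (hS : listSize (matCode M) ≤ S) :
    |denProd matIdx (matCode M)| ≤ 2 ^ (9 * S) := by
  have h := abs_denProd_le (idx := matIdx) (l := matCode M) (B := 2 ^ S)
    (fun p => by
      rw [matCode_getD_den]; exact abs_le_two_pow_of_mem (den_mem_matCode M _ _) hS)
  rw [← pow_mul, mul_comm] at h
  exact h

theorem abs_scaledEntry_vecCode_le {S : ℕ} (hS : listSize (vecCode s) ≤ S) (i : Fin 3) :
    |scaledEntry vecIdx (vecCode s) i| ≤ 2 ^ (3 * S) := by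
  have h := abs_scaledEntry_le (idx := vecIdx) (l := vecCode s) (B := 2 ^ S)
    (fun i => by
      rw [vecCode_getD_num]; exact abs_le_two_pow_of_mem (num_mem_vecCode s _) hS)
    (fun i => by
      rw [vecCode_getD_den]; exact abs_le_two_pow_of_mem (den_mem_vecCode s _) hS) i
  rw [← pow_mul, mul_comm] at h
  exact h

theorem abs_denProd_vecCode_le {S : ℕ} (hS : listSize (vecCode s) ≤ S) :
    |denProd vecIdx (vecCode s)| ≤ 2 ^ (3 * S) := by
  have h := abs_denProd_le (idx := vecIdx) (l := vecCode s) (B := 2 ^ S)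
    (fun i => by
      rw [vecCode_getD_den]; exact abs_le_two_pow_of_mem (den_mem_vecCode s _) hS)
  rw [← pow_mul, mul_comm] at h
  exact h

end

/-! ### The eigenvalues of the scaled matrix -/

theorem charpoly_smul_eq_prod {M : Matrix (Fin 3) (Fin 3) ℝ} {ρ : Fin 3 → ℝ}
    (h : M.charpoly = ∏ i, (Polynomial.X - Polynomial.C (ρ i))) {D : ℝ} (hD : D ≠ 0) :
    (D • M).charpoly = ∏ i, (Polynomial.X - Polynomial.C (D * ρ i)) := by
  refine Polynomial.funext fun x => ?_
  have h1 : scalar (Fin 3) x - D • M = D • (scalar (Fin 3) (x / D) - M) := by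
    rw [smul_sub]
    congr 1
    ext i j
    by_cases hij : i = j
    · subst hij; simp [mul_div_cancel₀ x hD]
    · simp [hij]
  have h2 := congrArg (Polynomial.eval (x / D)) h
  rw [eval_charpoly] at h2
  rw [eval_charpoly, h1, det_smul, h2]
  simp only [Fin.prod_univ_three, Polynomial.eval_mul, Polynomial.eval_sub, Polynomial.eval_X,
    Polynomial.eval_C, Fintype.card_fin]
  field_simp

theorem prod_sub_scalar_eq_zero {A : Matrix (Fin 3) (Fin 3) ℝ} {α : Fin 3 → ℝ}
    (h : A.charpoly = ∏ i, (Polynomial.X - Polynomial.C (α i))) :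
    (A - scalar (Fin 3) (α 2)) * (A - scalar (Fin 3) (α 1)) * (A - scalar (Fin 3) (α 0)) = 0 := by
  have h1 := aeval_self_charpoly A
  rw [h, Fin.prod_univ_three, mul_assoc, mul_comm,
    mul_comm (Polynomial.X - Polynomial.C (α 1)), map_mul, map_mul] at h1
  simpa [← algebraMap_eq_diagonal, ← scalar_apply, Matrix.scalar, Polynomial.aeval_C] using h1

/-- Gershgorin's circle theorem. -/
theorem abs_root_le {A : Matrix (Fin 3) (Fin 3) ℝ} {x B : ℝ} (hx : A.charpoly.IsRoot x)
    (hA : ∀ i j, |A i j| ≤ B) : |x| ≤ 3 * B := by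
  have h : Module.End.HasEigenvalue (Matrix.toLin' A) x := by
    rw [Module.End.hasEigenvalue_iff_mem_spectrum, spectrum_toLin']
    exact mem_spectrum_iff_isRoot_charpoly.2 hx
  obtain ⟨k, hk⟩ := eigenvalue_mem_ball h
  rw [mem_closedBall_iff_norm] at hk
  simp only [Real.norm_eq_abs] at hk
  have h1 : |x| ≤ |A k k| + ∑ j ∈ Finset.univ.erase k, |A k j| := by
    have := abs_add_le (x - A k k) (A k k)
    rw [sub_add_cancel] at this
    linarith
  rw [Finset.add_sum_erase _ (fun j => |A k j|) (Finset.mem_univ k)] at h1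
  calc |x| ≤ ∑ j, |A k j| := h1
    _ ≤ ∑ _j : Fin 3, B := Finset.sum_le_sum fun j _ => hA k j
    _ = 3 * B := by simp

theorem abs_le_of_charpoly_eq_prod {A : Matrix (Fin 3) (Fin 3) ℝ} {α : Fin 3 → ℝ} {B : ℝ}
    (h : A.charpoly = ∏ i, (Polynomial.X - Polynomial.C (α i))) (hA : ∀ i j, |A i j| ≤ B)
    (i : Fin 3) : |α i| ≤ 3 * B := by
  refine abs_root_le ?_ hA
  rw [h, Polynomial.IsRoot, Polynomial.eval_prod]
  exact Finset.prod_eq_zero (Finset.mem_univ i) (by simp)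

/-- Scaling by the common denominator `D` turns the roots `ρ i` into `D * ρ i`, the roots of the
characteristic polynomial of an integer matrix. -/
theorem exists_integralTriple {M : Matrix (Fin 3) (Fin 3) ℚ} (hM : HasThreeRealEigenvalues M) :
    ∃ α : Fin 3 → ℝ, IntegralTriple α ∧
      ((scaledMat (matCode M)).map (Int.cast : ℤ → ℝ)).charpoly =
        ∏ i, (Polynomial.X - Polynomial.C (α i)) ∧
      ((α 0 ≠ α 1 ∧ α 0 ≠ α 2 ∧ α 1 ≠ α 2) ∨ α 0 = α 1) := by
  obtain ⟨ρ, hρ⟩ := hM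
  set D : ℤ := denProd matIdx (matCode M) with hD
  have hD0 : (D : ℝ) ≠ 0 := by
    have := denProd_pos (f := fun p : Fin 3 × Fin 3 => M p.1 p.2) (matCode_getD_den M)
    exact_mod_cast this.ne'
  obtain ⟨τ, hτ⟩ := exists_perm_sorted fun i => D * ρ i
  have hA : (scaledMat (matCode M)).map (Int.cast : ℤ → ℝ) =
      (D : ℝ) • M.map (fun q : ℚ => (q : ℝ)) := by
    ext i j
    have := congrFun (congrFun (scaledMat_map_rat M) i) j
    simp only [map_apply, Matrix.smul_apply, smul_eq_mul] at this ⊢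
    exact_mod_cast congrArg (Rat.cast : ℚ → ℝ) this
  have hchar : ((scaledMat (matCode M)).map (Int.cast : ℤ → ℝ)).charpoly =
      ∏ i, (Polynomial.X - Polynomial.C (((fun i => D * ρ i) ∘ τ) i)) := by
    rw [hA, charpoly_smul_eq_prod hρ hD0]
    exact (Equiv.prod_comp τ fun i => Polynomial.X - Polynomial.C (D * ρ i)).symm
  refine ⟨(fun i => D * ρ i) ∘ τ, ⟨(scaledMat (matCode M)).charpoly, ?_⟩, hchar, hτ⟩
  rw [← charpoly_map, ← hchar]
  rfl

/-! ### Eventual periodicity with an effective bound -/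

/-- This is the threshold of `ExpPoly.exists_sign` with degree `3d` and `B = H^(57d+1)`. The last
factor dominates, with `21186 = 321 * 6 * 11`, and `21234 = 12 + 36 + 21186`. -/
theorem threshold_le {S d : ℕ} (hS : 25 ≤ S) (hd : d + 1 ≤ S) {H : ℝ} (hH : H = 2 ^ (11 * S)) :
    3 ^ (2 * (3 * d)) * ((2 * (3 * d) + 1).factorial : ℝ) *
      (32 * (H ^ (57 * d + 1)) ^ 5 * H ^ (12 * (3 * d))) ^ (2 * (3 * d) + 3) ≤
        2 ^ (21234 * S ^ 3) := by
  have hH1 : 1 ≤ H := by rw [hH]; exact one_le_pow₀ (by norm_num)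
  have h1 : (3 : ℝ) ^ (2 * (3 * d)) ≤ 2 ^ (12 * S) := by
    calc (3 : ℝ) ^ (2 * (3 * d)) ≤ (2 ^ 2) ^ (2 * (3 * d)) := by
          gcongr; norm_num
      _ = 2 ^ (12 * d) := by rw [← pow_mul]; congr 1; ring
      _ ≤ 2 ^ (12 * S) := pow_le_pow_right₀ (by norm_num) (by omega)
  have h2 : ((2 * (3 * d) + 1).factorial : ℝ) ≤ 2 ^ (36 * S ^ 2) := by
    have : (2 * (3 * d) + 1).factorial ≤ 2 ^ (36 * S ^ 2) := by
      calc (2 * (3 * d) + 1).factorial ≤ (2 * (3 * d) + 1) ^ (2 * (3 * d) + 1) :=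
            Nat.factorial_le_pow _
        _ ≤ (6 * S) ^ (6 * S) := by
            refine (Nat.pow_le_pow_left (by omega) _).trans (Nat.pow_le_pow_right ?_ ?_) <;> omega
        _ ≤ (2 ^ (6 * S)) ^ (6 * S) := Nat.pow_le_pow_left Nat.lt_two_pow_self.le _
        _ = 2 ^ (36 * S ^ 2) := by rw [← pow_mul]; congr 1; ring
    exact_mod_cast this
  have h32 : (32 : ℝ) ≤ H ^ 5 := by
    rw [hH, ← pow_mul]
    calc (32 : ℝ) = 2 ^ 5 := by norm_num
      _ ≤ _ := pow_le_pow_right₀ (by norm_num) (by omega)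
  have h3 : (32 * (H ^ (57 * d + 1)) ^ 5 * H ^ (12 * (3 * d))) ^ (2 * (3 * d) + 3) ≤
      2 ^ (21186 * S ^ 3) := by
    calc (32 * (H ^ (57 * d + 1)) ^ 5 * H ^ (12 * (3 * d))) ^ (2 * (3 * d) + 3)
        ≤ (H ^ 5 * (H ^ (57 * d + 1)) ^ 5 * H ^ (12 * (3 * d))) ^ (2 * (3 * d) + 3) := by gcongr
      _ = H ^ ((321 * d + 10) * (6 * d + 3)) := by
          rw [← pow_mul, ← pow_add, ← pow_add, ← pow_mul]; congr 1; ring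
      _ ≤ H ^ ((321 * S) * (6 * S)) :=
          pow_le_pow_right₀ hH1 (Nat.mul_le_mul (by omega) (by omega))
      _ = 2 ^ (21186 * S ^ 3) := by rw [hH, ← pow_mul]; congr 1; ring
  calc _ ≤ (2 : ℝ) ^ (12 * S) * 2 ^ (36 * S ^ 2) * 2 ^ (21186 * S ^ 3) := by gcongr
    _ = 2 ^ (12 * S + 36 * S ^ 2 + 21186 * S ^ 3) := by rw [← pow_add, ← pow_add]
    _ ≤ 2 ^ (21234 * S ^ 3) := by
        refine pow_le_pow_right₀ (by norm_num) ?_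
        have e1 : S ≤ S ^ 3 := Nat.le_self_pow (by norm_num) S
        have e2 : S ^ 2 ≤ S ^ 3 := Nat.pow_le_pow_right (by omega) (by norm_num)
        omega

section

variable (M : Matrix (Fin 3) (Fin 3) ℚ) (s : Fin 3 → ℚ) (T : AtomicSemialgebraic)

/-- Up to a constant factor, the scaled orbit and its denominator are exponential polynomials
over the eigenvalues. -/
theorem exists_scaledOrbit_expPoly {α : Fin 3 → ℝ} {H : ℝ} {S : ℕ} (hS : 1 ≤ S)
    (hSM : listSize (matCode M) ≤ S) (hSs : listSize (vecCode s) ≤ S) (hH : H = 2 ^ (11 * S))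
    (hchar : ((scaledMat (matCode M)).map (Int.cast : ℤ → ℝ)).charpoly =
        ∏ i, (Polynomial.X - Polynomial.C (α i)))
    (hα : (α 0 ≠ α 1 ∧ α 0 ≠ α 2 ∧ α 1 ≠ α 2) ∨ α 0 = α 1) :
    ∃ W : ℝ, W ≠ 0 ∧
      (∀ i, ExpPoly α H 1 (H ^ 19)
        fun n => W * (scaledOrbit (instanceCode M s T) (n + 2) i : ℝ)) ∧
      ExpPoly α H 1 (H ^ 19) fun n => W * (scaledDen (instanceCode M s T) (n + 2) : ℝ) := by
  have hpow : ∀ k, k ≤ 11 * S → (2 : ℝ) ^ k ≤ H := fun k hk => by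
    rw [hH]; exact pow_le_pow_right₀ (by norm_num) hk
  have hH2 : 2 ≤ H := by simpa using hpow 1 (by omega)
  have hcast : ∀ (z : ℤ) (k : ℕ), |z| ≤ 2 ^ k → k ≤ 11 * S → |(z : ℝ)| ≤ H := fun z k hz hk =>
    le_trans (by exact_mod_cast hz) (hpow k hk)
  have hA : ∀ i j, |((scaledMat (matCode M) i j : ℤ) : ℝ)| ≤ 2 ^ (9 * S) := fun i j => by
    exact_mod_cast abs_scaledMat_le M hSM i j
  -- The eigenvalue bound `3 * 2^(9S) ≤ 2^(9S+2)` is the largest quantity that `H = 2^(11S)` has to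
  -- cover.
  have hroot : ∀ i, |α i| ≤ H := fun i => by
    have h1 : |α i| ≤ 3 * 2 ^ (9 * S) := abs_le_of_charpoly_eq_prod hchar hA i
    have h2 : (2 : ℝ) ^ (9 * S + 2) = 4 * 2 ^ (9 * S) := by rw [pow_add]; ring
    have h3 : (0 : ℝ) < 2 ^ (9 * S) := by positivity
    linarith [hpow (9 * S + 2) (by omega)]
  obtain ⟨W, hW0, hW, hx⟩ := exists_pow_mulVec_expPoly hH2 hroot hα (scaledMat (matCode M))
    (scaledEntry vecIdx (vecCode s)) (fun i j => (hA i j).trans (hpow _ (by omega)))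
    (fun i => hcast _ _ (abs_scaledEntry_vecCode_le s hSs i) (by omega))
    (prod_sub_scalar_eq_zero hchar)
  have hD : ConjBounded α (denProd matIdx (matCode M) : ℝ) H :=
    (ConjBounded.int _).mono (hcast _ _ (abs_denProd_matCode_le M hSM) (by omega))
  have hE : ConjBounded α (denProd vecIdx (vecCode s) : ℝ) H :=
    (ConjBounded.int _).mono (hcast _ _ (abs_denProd_vecCode_le s hSs) (by omega))
  refine ⟨W, hW0, fun i => (hx i).congr fun n => ?_,
    ((ExpPoly.const_mul ((hW.mul hE).mul (hD.mul hD))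
      (ExpPoly.pow_mul_geom hD (j := 0) (by norm_num))).mono ?_).congr fun n => ?_⟩
  · rw [scaledOrbit_eq]
    simp only [instanceCode]
  · calc H ^ 6 * H * (H * H) * 1 = H ^ 9 := by ring
      _ ≤ H ^ 19 := pow_le_pow_right₀ (by linarith) (by norm_num)
  · simp only [scaledDen, instanceCode]
    push_cast
    ring

/-- Evaluating a polynomial at exponential polynomials. -/
theorem ExpPoly.sum_homMonomial {α : Fin 3 → ℝ} {H W : ℝ} {x : ℕ → Fin 3 → ℝ} {q : ℕ → ℝ}
    (hx : ∀ i, ExpPoly α H 1 (H ^ 19) fun n => W * x n i)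
    (hq : ExpPoly α H 1 (H ^ 19) fun n => W * q n) (d : ℕ) (a : ℕ × ℕ × ℕ → ℤ)
    (ha : ((expTriples (d + 1)).map fun e => |(a e : ℝ)|).sum ≤ H) :
    ExpPoly α H (3 * d) (H ^ (57 * d + 1)) fun n => W ^ (3 * d) *
      ((expTriples (d + 1)).map fun e => (a e : ℝ) * homMonomial (3 * d) (x n) (q n) e).sum := by
  have hterm : ∀ e ∈ expTriples (d + 1), ExpPoly α H (3 * d) (|(a e : ℝ)| * H ^ (57 * d))
      fun n => (a e : ℝ) * (W ^ (3 * d) * homMonomial (3 * d) (x n) (q n) e) := by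
    intro e he
    have hle := degree_le_of_mem_expTriples he
    refine ExpPoly.const_mul (ConjBounded.int _) ?_
    -- There are `3d` factors counted with multiplicity, each bounded by `H^19`, hence `57d`; the
    -- coefficients of the polynomial add the final factor `H`.
    have h := ((((hx 0).pow e.1).mul ((hx 1).pow e.2.1)).mul ((hx 2).pow e.2.2)).mul
      (hq.pow (3 * d - e.1 - e.2.1 - e.2.2))
    have e1 : e.1 * 1 + e.2.1 * 1 + e.2.2 * 1 + (3 * d - e.1 - e.2.1 - e.2.2) * 1 = 3 * d := by
      omega
    rw [e1] at h
    refine (h.mono (le_of_eq ?_)).congr fun n => ?_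
    · rw [← pow_add, ← pow_add, ← pow_add, ← pow_mul]
      congr 1
      omega
    · rw [← homMonomial_smul _ _ _ hle, homMonomial]
  have hH : 0 ≤ H := by
    refine le_trans (List.sum_nonneg ?_) ha
    simp only [List.mem_map]
    rintro _ ⟨e, -, rfl⟩
    exact abs_nonneg _
  refine ((ExpPoly.list_sum _ hterm).mono ?_).congr fun n => ?_
  · rw [List.sum_map_mul_right, pow_succ, mul_comm]
    gcongr
  · rw [← List.sum_map_mul_left]
    congr 1
    refine List.map_congr_left fun e _ => ?_
    ring

theorem sum_abs_coeff_le (p : MvPolynomial (Fin 3) ℤ) :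
    ((expTriples (p.totalDegree + 1)).map
      fun e => |((p.coeff (tripleExp e) : ℤ) : ℝ)|).sum ≤ 2 ^ listSize (polyCode p) := by
  have h1 := sum_abs_le_two_pow_listSize (polyCode p)
  rw [polyCode_eq, List.map_map, ← polyCode_eq] at h1
  have h2 := (Int.cast_le (R := ℝ)).2 h1
  push_cast at h2
  rw [List.map_map] at h2
  refine le_trans (le_of_eq ?_) h2
  congr 2
  ext e
  simp

/-- Up to a constant factor, the values of the polynomial along the orbit form an exponential
polynomial over the eigenvalues. -/
theorem exists_scaledValue_expPoly {α : Fin 3 → ℝ} {H : ℝ}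
    (hH : H = 2 ^ (11 * instanceSize M s T))
    (hchar : ((scaledMat (matCode M)).map (Int.cast : ℤ → ℝ)).charpoly =
        ∏ i, (Polynomial.X - Polynomial.C (α i)))
    (hα : (α 0 ≠ α 1 ∧ α 0 ≠ α 2 ∧ α 1 ≠ α 2) ∨ α 0 = α 1) :
    ∃ c : ℝ, c ≠ 0 ∧ ExpPoly α H (3 * T.poly.totalDegree) (H ^ (57 * T.poly.totalDegree + 1))
      fun n => c * scaledValue (instanceCode M s T) (n + 2) := by
  have hS := twentyFive_le_instanceSize M s T
  obtain ⟨W, hW0, hx, hq⟩ := exists_scaledOrbit_expPoly M s T (S := instanceSize M s T)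
    (by omega) (by unfold instanceSize; omega) (by unfold instanceSize; omega) hH hchar hα
  refine ⟨W ^ (3 * T.poly.totalDegree), pow_ne_zero _ hW0,
    (ExpPoly.sum_homMonomial hx hq _ (fun e => T.poly.coeff (tripleExp e))
      ((sum_abs_coeff_le T.poly).trans ?_)).congr fun n => ?_⟩
  · rw [hH]
    refine pow_le_pow_right₀ (by norm_num) ?_
    unfold instanceSize
    omega
  · rw [scaledValue_cast_eq_sum]

theorem orbit_mem_iff_of_mod_eq (hM : HasThreeRealEigenvalues M) {n n' : ℕ}
    (hn : 2 ^ (instanceSize M s T ^ 7) < n) (hn' : 2 ^ (instanceSize M s T ^ 7) < n')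
    (hmod : n % 2 = n' % 2) : orbit M s n ∈ T.toSet ↔ orbit M s n' ∈ T.toSet := by
  obtain ⟨α, hint, hchar, hα⟩ := exists_integralTriple hM
  obtain ⟨c, hc, hexp⟩ := exists_scaledValue_expPoly M s T rfl hchar hα
  set S := instanceSize M s T with hS
  have hS25 : 25 ≤ S := twentyFive_le_instanceSize M s T
  have hH1 : (1 : ℝ) ≤ 2 ^ (11 * S) := one_le_pow₀ (by norm_num)
  obtain ⟨ε, hε⟩ := hexp.exists_sign hint hH1 (one_le_pow₀ hH1) (r := n % 2) (by omega)
  have key : ∀ m, 2 ^ (S ^ 7) < m → m % 2 = n % 2 →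
      SignType.sign (c * (scaledValue (instanceCode M s T) m : ℝ)) = ε := by
    intro m hm hmn
    -- The factor 8 is slack for passing from `m` to `k = (m - 2) / 2`. The exponent 7 works because
    -- `S⁴ ≥ 25⁴` absorbs the constants; the index shift by 2 preserves parity.
    have hbig : 2 ^ (21234 * S ^ 3) * 8 ≤ 2 ^ (S ^ 7) := by
      have h1 : 21234 * S ^ 3 + 3 ≤ S ^ 7 := by
        have h2 : 25 ^ 4 ≤ S ^ 4 := Nat.pow_le_pow_left hS25 4
        have h3 : 1 ≤ S ^ 3 := Nat.one_le_pow _ _ (by omega)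
        have h4 : S ^ 7 = S ^ 4 * S ^ 3 := by ring
        nlinarith
      calc 2 ^ (21234 * S ^ 3) * 8 = 2 ^ (21234 * S ^ 3 + 3) := by rw [pow_add]; norm_num
        _ ≤ _ := Nat.pow_le_pow_right (by norm_num) h1
    have hone : 1 ≤ 2 ^ (21234 * S ^ 3) := Nat.one_le_two_pow
    generalize 2 ^ (S ^ 7) = Y at hbig hm
    have hk : 2 ^ (21234 * S ^ 3) < (m - 2) / 2 := by omega
    have h := hε ((m - 2) / 2) (lt_of_le_of_lt
      (threshold_le hS25 (totalDegree_lt_instanceSize M s T) rfl) (by exact_mod_cast hk))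
    have hm2 : 2 * ((m - 2) / 2) + n % 2 + 2 = m := by omega
    rw [hm2] at h
    exact h
  -- The sign of `c` is unknown, but it is the same for `n` and `n'` and cancels.
  have heq : SignType.sign (scaledValue (instanceCode M s T) n : ℝ) =
      SignType.sign (scaledValue (instanceCode M s T) n' : ℝ) := by
    have h := (key n hn rfl).trans (key n' hn' hmod.symm).symm
    rw [sign_mul, sign_mul] at h
    exact mul_left_cancel₀ (sign_ne_zero.2 hc) h
  rw [mem_toSet_iff_signTest, mem_toSet_iff_signTest]
  unfold signTest
  rw [← Int.cast_pos (R := ℝ), ← sign_eq_one_iff, ← Int.cast_nonneg_iff (R := ℝ),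
    ← sign_nonneg_iff, heq, sign_eq_one_iff, sign_nonneg_iff, Int.cast_pos, Int.cast_nonneg_iff]

theorem residueSet_subset (C : ℕ) (w : Input) : residueSet C w ⊆ {0, 1} := by
  intro r hr
  simp only [residueSet, Finset.mem_filter] at hr
  exact hr.1

theorem mem_residueSet_iff {C r : ℕ} (hr : r < 2) :
    r ∈ residueSet C (instanceCode M s T) ↔
      orbit M s (testIndex C (instanceCode M s T) r) ∈ T.toSet := by
  rw [mem_toSet_iff_signTest]
  interval_cases r <;> simp [residueSet]

end

end OrbitLDS

theorem theorem12 :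
    ∃ (C : ℕ) (X : OrbitLDS.Input → Finset ℕ),
      (∀ w : OrbitLDS.Input, X w ⊆ {0, 1}) ∧
      -- the set `X w` is computed by an algorithm from the input `w`
      ComputablePred (fun q : OrbitLDS.Input × ℕ => q.2 ∈ X q.1) ∧
      ∀ (M : Matrix (Fin 3) (Fin 3) ℚ) (s : Fin 3 → ℚ) (T : OrbitLDS.AtomicSemialgebraic),
        OrbitLDS.HasThreeRealEigenvalues M →
        ∃ N : ℕ, N ≤ 2 ^ (OrbitLDS.instanceSize M s T ^ C) ∧
          ∀ n : ℕ, N < n →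
            (OrbitLDS.orbit M s n ∈ T.toSet ↔
              n % 2 ∈ X (OrbitLDS.instanceCode M s T)) := by
  refine ⟨7, OrbitLDS.residueSet 7, OrbitLDS.residueSet_subset 7,
    OrbitLDS.computable_residueSet 7, fun M s T hM => ⟨_, le_rfl, fun n hn => ?_⟩⟩
  rw [OrbitLDS.mem_residueSet_iff M s T (Nat.mod_lt n two_pos)]
  refine OrbitLDS.orbit_mem_iff_of_mod_eq M s T hM hn ?_ ?_
  -- The test index lies past the threshold, and its part other than the residue is even, so it
  -- represents the parity class of `n`.
  · have h : 2 ^ (OrbitLDS.instanceSize M s T ^ 7) ≤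
        2 ^ (OrbitLDS.crudeSize (OrbitLDS.instanceCode M s T) ^ 7) :=
      Nat.pow_le_pow_right two_pos
        (Nat.pow_le_pow_left (OrbitLDS.instanceSize_le_crudeSize M s T) 7)
    unfold OrbitLDS.testIndex
    omega
  · unfold OrbitLDS.testIndex
    omega
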